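/- Let $B$ be a finite-dimensional vector space over $\mathbb Z/2\mathbb Z$, and let $\omega=(\omega_i)_{i\ge1}$ be a sequence of non-zero elements of the dual space $B^*$. Let $\mathcal T$ be the infinite binary rooted tree, with vertices the finite words over $\{0,1\}$; let $a$ be the automorphism exchanging its two maximal subtrees, and let $b\in B$ act on $\mathcal T$ by $b=\langle\langle \omega_1(b),\,b@1\rangle\rangle$, $b@1^k=\langle\langle\omega_{k+1}(b),\,b@1^{k+1}\rangle\rangle$ ($k\ge1$), where $\langle\langle g,h\rangle\rangle$ acts as $g$ on the subtree at $0$ and as $h$ on the subtree at $1$, and the values $0,1\in\mathbb Z/2\mathbb Z$ stand for the identity and $a$. The spinal group $G_\omega$ is the subgroup of $\operatorname{Aut}\mathcal T$ generated by $a$ and $B$, and $G_\omega\bmod m$ is its quotient by the pointwise stabilizer of the $m$-th level. Decompose $\omega$ into syllables, i.e. maximal blocks of consecutive equal letters (if $\omega$ is eventually constant, the last block is infinite). Let $a_k$ be the length of the $k$-th syllable, $s_k=a_1+\dots+a_k$, $s_0=0$, and $\Sigma_k=\sum_{j=1}^k2^{s_{j-1}}a_j$. For $m\ge2$ let $s^{-1}(m)$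 be the only integer with $s_{s^{-1}(m)-1}+1<m\le s_{s^{-1}(m)}+1$, i.e. the number of syllables of the prefix of $\omega$ of length $m-1$, and set $s^{-1}(1)=0$. Let $\dim(\omega\bmod m)$ be the dimension of the span of the letters of the first $s^{-1}(m)$ syllables of $\omega$, and let $\sigma$ be the shift $\omega_1\omega_2\omega_3\dots\mapsto\omega_2\omega_3\dots$. Suppose that $\dim(\omega\bmod m)=n$ with $n\ge2$. For each $j\in\{1,\dots,n-1\}$ there is an integer $\lambda\geq 0$ with $s_\lambda<m$ and $\dim(\sigma^{s_{\lambda}}\omega\bmod(m-s_{\lambda}))=j$; let $\lambda_j$ be the smallest one. Then $\lambda_j\ge1$, and $$\log_2|G_\omega\bmod m|=3+\Sigma_{s^{-1}(m)-1}+\sum_{i=2}^{n-1}\bigl(2^{s_{\lambda_i}+1}-2^{s_{\lambda_i-1}}\bigr)-2^{s_{\lambda_1-1}}+2^{s_{\lambda_1}}(m-s_{\lambda_1}).$$ -/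

import Mathlib

namespace Spinal

/-! ### The binary rooted tree

Vertices are the finite words over `{0, 1}`, with `false` for `0` and `true` for `1`. -/

/-- The automorphism group of the infinite binary rooted tree: the permutations of the finite
words that preserve the level (length) and the prefix relation. -/
def AutT : Subgroup (Equiv.Perm (List Bool)) where
  carrier := {g | (∀ u, (g u).length = u.length) ∧ ∀ u v, g u <+: g v ↔ u <+: v}
  mul_mem' := by
    rintro g h ⟨hg, hg'⟩ ⟨hh, hh'⟩
    exact ⟨fun u => by simp [hg, hh], fun u v => by simp [hg', hh']⟩
  one_mem' := by simp
  inv_mem' := by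
    rintro g ⟨hg, hg'⟩
    refine ⟨fun u => ?_, fun u v => ?_⟩
    · rw [← hg (g⁻¹ u), show g (g⁻¹ u) = u from g.apply_symm_apply u]
    · rw [← hg' (g⁻¹ u) (g⁻¹ v), show g (g⁻¹ u) = u from g.apply_symm_apply u,
        show g (g⁻¹ v) = v from g.apply_symm_apply v]

/-- An involution of the words that preserves lengths and prefixes, as a tree automorphism. -/
def autOfInvolutive (f : List Bool → List Bool) (hf : Function.Involutive f)
    (hlen : ∀ u, (f u).length = u.length) (hpre : ∀ u v, u <+: v → f u <+: f v) : AutT :=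
  ⟨hf.toPerm f, hlen, fun u v =>
    ⟨fun h => by simpa [hf u, hf v] using hpre _ _ h, hpre u v⟩⟩

/-- The fixator in `Aut T` of the `m`-th level of the tree. -/
def levelStab (m : ℕ) : Subgroup AutT where
  carrier := {g | ∀ w : List Bool, w.length = m → g.1 w = w}
  mul_mem' := by
    intro g h hg hh w hw
    change g.1 (h.1 w) = w
    rw [hh w hw, hg w hw]
  one_mem' := fun _ _ => rfl
  inv_mem' := by
    intro g hg w hw
    change g.1⁻¹ w = w
    rw [Equiv.Perm.inv_eq_iff_eq, hg w hw]

/-- `G mod m = G / Stab_G(m)`, the action of `G` on the first `m` levels. -/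
abbrev Quo (G : Subgroup AutT) (m : ℕ) : Type :=
  G ⧸ (levelStab m).subgroupOf G

/-! ### Spinal groups -/

/-- The action of `a`: exchange the two maximal subtrees. -/
def rootFun : List Bool → List Bool
  | [] => []
  | x :: w => (!x) :: w

theorem rootFun_involutive : Function.Involutive rootFun := by
  rintro (_ | ⟨x, w⟩) <;> simp [rootFun]

theorem rootFun_length (u : List Bool) : (rootFun u).length = u.length := by
  cases u <;> simp [rootFun]

theorem rootFun_prefix (u v : List Bool) (h : u <+: v) : rootFun u <+: rootFun v := by
  cases u with
  | nil => simp [rootFun]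
  | cons x u =>
    cases v with
    | nil => simp at h
    | cons y v =>
      rw [List.cons_prefix_cons] at h
      simp [rootFun, h.1, h.2]

/-- The automorphism `a`. -/
def rootAut : AutT :=
  autOfInvolutive rootFun rootFun_involutive rootFun_length rootFun_prefix

/-- The shift `ω₁ω₂… ↦ ω₂ω₃…`. -/
def shift {V : Type*} (ω : ℕ → V) : ℕ → V := fun i => ω (i + 1)

section
variable {B : Type*} [AddCommGroup B] [Module (ZMod 2) B]

/-- The action of `b ∈ B` given by `b = ⟨ω₁(b), b@1⟩`, where `b@1` acts as `b` does for the
shifted sequence, and the value `1` of `ω₁` stands for `a`. The letter `ω_{i+1}` is `ω i`. -/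
def spineFun : (ℕ → Module.Dual (ZMod 2) B) → B → List Bool → List Bool
  | _, _, [] => []
  | ω, b, false :: w => false :: (if ω 0 b = 0 then w else rootFun w)
  | ω, b, true :: w => true :: spineFun (shift ω) b w

theorem spineFun_involutive (ω : ℕ → Module.Dual (ZMod 2) B) (b : B) :
    Function.Involutive (spineFun ω b) := by
  intro u
  induction u generalizing ω with
  | nil => simp [spineFun]
  | cons x u ih =>
    cases x
    · by_cases h : ω 0 b = 0 <;> simp [spineFun, h, rootFun_involutive u]
    · simp [spineFun, ih]

theorem spineFun_length (ω : ℕ → Module.Dual (ZMod 2) B) (b : B) (u : List Bool) :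
    (spineFun ω b u).length = u.length := by
  induction u generalizing ω with
  | nil => simp [spineFun]
  | cons x u ih =>
    cases x
    · by_cases h : ω 0 b = 0 <;> simp [spineFun, h, rootFun_length u]
    · simp [spineFun, ih]

theorem spineFun_prefix (ω : ℕ → Module.Dual (ZMod 2) B) (b : B) (u v : List Bool)
    (huv : u <+: v) : spineFun ω b u <+: spineFun ω b v := by
  induction u generalizing ω v with
  | nil => simp [spineFun]
  | cons x u ih =>
    cases v with
    | nil => simp at huv
    | cons y v =>
      rw [List.cons_prefix_cons] at huv
      obtain ⟨rfl, huv⟩ := huv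
      cases x
      · by_cases h : ω 0 b = 0 <;> simp [spineFun, h, rootFun_prefix u v huv, huv]
      · simpa [spineFun] using ih (shift ω) v huv

/-- The automorphism of the tree by which `b ∈ B` acts. -/
def spineAut (ω : ℕ → Module.Dual (ZMod 2) B) (b : B) : AutT :=
  autOfInvolutive (spineFun ω b) (spineFun_involutive ω b) (spineFun_length ω b)
    (spineFun_prefix ω b)

/-- The spinal group `G_ω`, generated by `a` and (the images of) all `b ∈ B`. -/
def spinalGroup (ω : ℕ → Module.Dual (ZMod 2) B) : Subgroup AutT :=
  Subgroup.closure ({rootAut} ∪ Set.range (spineAut ω))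

end

/-! ### Syllable form

Syllables are numbered from `1`. If `ω` is eventually constant, its last syllable has infinite
length. -/

section
variable {V : Type*}

open Classical in
/-- The number of the syllable that contains the letter `ω i`. -/
noncomputable def syllableNumber (ω : ℕ → V) : ℕ → ℕ
  | 0 => 1
  | i + 1 => if ω (i + 1) = ω i then syllableNumber ω i else syllableNumber ω i + 1

/-- The multiplicity `a_k`, the number of letters of the `k`-th syllable. It is `0` if `ω` has
fewer than `k` syllables. -/
noncomputable def mult (ω : ℕ → V) (k : ℕ) : ℕ∞ :=
  Set.encard {i | syllableNumber ω i = k}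

/-- `s_k = a_1 + ⋯ + a_k`. -/
noncomputable def s (ω : ℕ → V) (k : ℕ) : ℕ∞ :=
  ∑ j ∈ Finset.Icc 1 k, mult ω j

/-- `s⁻¹(m)`, the only integer `k` with `s_{k-1} + 1 < m ≤ s_k + 1`; it is `0` if `m ≤ 1`. -/
noncomputable def sInv (ω : ℕ → V) (m : ℕ) : ℕ :=
  sInf {k | 1 ≤ k ∧ s ω (k - 1) + 1 < (m : ℕ∞) ∧ (m : ℕ∞) ≤ s ω k + 1}

/-- `Σ_k = 2^{s_0} a_1 + ⋯ + 2^{s_{k-1}} a_k`, for `k` such that `s_k` is finite. -/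
noncomputable def bigSigma (ω : ℕ → V) (k : ℕ) : ℕ :=
  ∑ j ∈ Finset.Icc 1 k, 2 ^ (s ω (j - 1)).toNat * (mult ω j).toNat

variable [AddCommGroup V] [Module (ZMod 2) V]

/-- `dim(ω mod m)`, the dimension of the span of the letters of the first `s⁻¹(m)` syllables. -/
noncomputable def dimMod (ω : ℕ → V) (m : ℕ) : ℕ :=
  Module.finrank (ZMod 2)
    (Submodule.span (ZMod 2) {φ | ∃ i, syllableNumber ω i ≤ sInv ω m ∧ ω i = φ})

/-- The integers `l` such that `dim(σ^{s_l} ω mod (m - s_l)) = j`, with `s_l < m`. -/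
def dropSet (ω : ℕ → V) (m j : ℕ) : Set ℕ :=
  {l | ∃ t : ℕ, s ω l = (t : ℕ∞) ∧ t < m ∧ dimMod (shift^[t] ω) (m - t) = j}

end

end Spinal

namespace Spinal

/-! ### Sections of tree automorphisms -/

/-! Strip letters from the front. Let `satGroup ω m` be the preimage in Aut T of G_ω mod m, and H =
`satGroup (shift ω) m`. The subgroup of `satGroup ω (m + 1)` fixing level one has index two and
embeds in H × H by its sections; the second projection is onto H. If ω₁ is outside the span of ω₂,
…, ω_m, some b acts as ⟨a, 1⟩ up to depth m + 1, the image is all of H × H, and the order is 2|H mod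
m|² (`quoCard_succ_of_notMem`). Otherwise b = ⟨ω₁(b), b@1⟩ ties an a on the left to b@1 on the
right. The quotient f of H by the normal closure of ker ω₁ is generated by two involutions, hence
dihedral, say of order 2k. The image is the fibre product of the pairs (g, h) for which f(g) and
f(h) correspond under the exchange of these involutions, and the order is divided by 2k
(`quoCard_succ_mul`). The value of k is 4 for a nonzero φ in the span of the letters that is not the
first letter, or is the first letter but outside the span of the later ones
(`nonempty_dihedralQuotient_four`). Each further φ put in front doubles k
(`DihedralQuotient.extend`). For a first syllable of length r, with L' the logarithm for the rest,
iteration gives L = 3 + r + 2^r(L' − 3) if its letter recurs in the span of the rest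
(`logCard_of_mem`), and L = 2 + r + 2^r(L' − 1) if not (`logCard_of_notMem`). The formula obeys the
same recursion: Σ becomes r + 2^r Σ', and the powers of two are multiplied by 2^r. In the second
case the dimension n − 1 is reached after one syllable, whose summand 2^{r+1} − 1 is exactly the
difference between the two recursions. For n = 2 the rest is constant and its order is known
(`logCard_of_const`). -/

theorem AutT.ext {g h : AutT} (H : ∀ w, g.1 w = h.1 w) : g = h :=
  Subtype.ext (Equiv.ext H)

theorem AutT.length_apply (g : AutT) (u : List Bool) : (g.1 u).length = u.length := g.2.1 u

theorem AutT.mul_apply (g h : AutT) (u : List Bool) : (g * h).1 u = g.1 (h.1 u) := rfl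

theorem AutT.apply_nil (g : AutT) : g.1 [] = [] :=
  List.eq_nil_of_length_eq_zero (AutT.length_apply g [])

theorem AutT.inv_apply_self (g : AutT) (u : List Bool) : (g⁻¹).1 (g.1 u) = u :=
  g.1.symm_apply_apply u

theorem AutT.apply_inv_self (g : AutT) (u : List Bool) : g.1 ((g⁻¹).1 u) = u :=
  g.1.apply_symm_apply u

/-- Whether `g` exchanges the two maximal subtrees. -/
def swp (g : AutT) : Bool := decide (g.1 [false] = [true])

theorem AutT.apply_singleton (g : AutT) (x : Bool) : g.1 [x] = [xor x (swp g)] := by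
  have h (y : Bool) : g.1 [y] = [false] ∨ g.1 [y] = [true] := by
    obtain ⟨z, hz⟩ := List.length_eq_one_iff.1 (AutT.length_apply g [y])
    cases z <;> simp [hz]
  have hne : g.1 [false] ≠ g.1 [true] := fun h => by simpa using g.1.injective h
  rcases h false with h0 | h0 <;> rcases h true with h1 | h1 <;> cases x <;>
    simp_all [swp]

theorem AutT.exists_apply_cons (g : AutT) (x : Bool) (w : List Bool) :
    ∃ v, g.1 (x :: w) = xor x (swp g) :: v := by
  have h : g.1 [x] <+: g.1 (x :: w) := (g.2.2 _ _).2 (by simp)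
  rw [AutT.apply_singleton g] at h
  obtain ⟨v, hv⟩ := h
  exact ⟨v, by simpa using hv.symm⟩

theorem AutT.apply_cons_tail (g : AutT) (x : Bool) (w : List Bool) :
    g.1 (x :: w) = xor x (swp g) :: (g.1 (x :: w)).tail := by
  obtain ⟨v, hv⟩ := AutT.exists_apply_cons g x w
  simp [hv]

theorem AutT.inv_apply_cons_tail (g : AutT) (x : Bool) (w : List Bool) :
    (g⁻¹).1 (xor x (swp g) :: w) = x :: ((g⁻¹).1 (xor x (swp g) :: w)).tail := by
  have h := AutT.apply_cons_tail g⁻¹ (xor x (swp g)) w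
  have h2 : (g⁻¹).1 [xor x (swp g)] = [x] := by
    rw [← AutT.apply_singleton g, AutT.inv_apply_self g]
  rw [AutT.apply_singleton g⁻¹] at h2
  rw [List.cons.inj h2 |>.1] at h
  exact h

/-- The section of `g` at the vertex `x` of the first level. -/
def sec (g : AutT) (x : Bool) : AutT :=
  ⟨{ toFun := fun w => (g.1 (x :: w)).tail
     invFun := fun w => ((g⁻¹).1 (xor x (swp g) :: w)).tail
     left_inv := fun w => by
       change ((g⁻¹).1 (xor x (swp g) :: (g.1 (x :: w)).tail)).tail = w
       rw [← AutT.apply_cons_tail g, AutT.inv_apply_self g]; rfl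
     right_inv := fun w => by
       change (g.1 (x :: ((g⁻¹).1 (xor x (swp g) :: w)).tail)).tail = w
       rw [← AutT.inv_apply_cons_tail g, AutT.apply_inv_self g]; rfl },
   fun u => by
     change (g.1 (x :: u)).tail.length = _
     simp [AutT.length_apply g],
   fun u v => by
     change (g.1 (x :: u)).tail <+: (g.1 (x :: v)).tail ↔ _
     have h := g.2.2 (x :: u) (x :: v)
     rw [AutT.apply_cons_tail g x u, AutT.apply_cons_tail g x v, List.cons_prefix_cons] at h
     simpa using h⟩

theorem AutT.apply_cons (g : AutT) (x : Bool) (w : List Bool) :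
    g.1 (x :: w) = xor x (swp g) :: (sec g x).1 w := AutT.apply_cons_tail g x w

theorem swp_sec_of_apply {g : AutT} {c : Bool} {k : Bool → AutT}
    (h : ∀ x w, g.1 (x :: w) = xor x c :: (k x).1 w) : swp g = c ∧ ∀ x, sec g x = k x := by
  have h1 : ∀ x w, xor x (swp g) = xor x c ∧ (sec g x).1 w = (k x).1 w := fun x w => by
    have := h x w
    rw [AutT.apply_cons g] at this
    simpa using this
  exact ⟨by simpa using (h1 false []).1, fun x => AutT.ext fun w => (h1 x w).2⟩

theorem AutT.ext_sec {g h : AutT} (h0 : swp g = swp h) (h1 : ∀ x, sec g x = sec h x) : g = h := by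
  refine AutT.ext fun w => ?_
  cases w with
  | nil => rw [AutT.apply_nil g, AutT.apply_nil h]
  | cons x w => rw [AutT.apply_cons g, AutT.apply_cons h, h0, h1]

theorem swp_sec_mul (g h : AutT) :
    swp (g * h) = xor (swp h) (swp g) ∧ ∀ x, sec (g * h) x = sec g (xor x (swp h)) * sec h x :=
  swp_sec_of_apply fun x w => by
    rw [AutT.mul_apply, AutT.apply_cons h, AutT.apply_cons g, Bool.xor_assoc]; rfl

@[simp] theorem swp_mul (g h : AutT) : swp (g * h) = xor (swp h) (swp g) := (swp_sec_mul g h).1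

@[simp] theorem sec_mul (g h : AutT) (x : Bool) :
    sec (g * h) x = sec g (xor x (swp h)) * sec h x := (swp_sec_mul g h).2 x

theorem swp_sec_one : swp 1 = false ∧ ∀ x, sec 1 x = 1 :=
  swp_sec_of_apply fun x w => by simp

@[simp] theorem swp_one : swp 1 = false := swp_sec_one.1

@[simp] theorem sec_one (x : Bool) : sec 1 x = 1 := swp_sec_one.2 x

@[simp] theorem swp_inv (g : AutT) : swp g⁻¹ = swp g := by
  have h := swp_mul g g⁻¹
  rw [mul_inv_cancel, swp_one] at h
  revert h; cases swp g <;> cases swp g⁻¹ <;> simp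

@[simp] theorem sec_inv (g : AutT) (x : Bool) : sec g⁻¹ x = (sec g (xor x (swp g)))⁻¹ := by
  have h := sec_mul g g⁻¹ x
  rw [mul_inv_cancel, sec_one, swp_inv] at h
  exact (inv_eq_of_mul_eq_one_right h.symm).symm

theorem swp_sec_rootAut : swp rootAut = true ∧ ∀ x, sec rootAut x = 1 :=
  swp_sec_of_apply fun x w => by
    change rootFun (x :: w) = _
    simp [rootFun]

@[simp] theorem swp_rootAut : swp rootAut = true := swp_sec_rootAut.1

@[simp] theorem sec_rootAut (x : Bool) : sec rootAut x = 1 := swp_sec_rootAut.2 x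

theorem mul_self_autOfInvolutive {f : List Bool → List Bool} (hf : Function.Involutive f)
    (hlen : ∀ u, (f u).length = u.length) (hpre : ∀ u v, u <+: v → f u <+: f v) :
    autOfInvolutive f hf hlen hpre * autOfInvolutive f hf hlen hpre = 1 :=
  AutT.ext fun w => hf w

@[simp] theorem rootAut_mul_self : rootAut * rootAut = 1 := mul_self_autOfInvolutive _ _ _

/-- The map acting as `g` below the vertex `0` and as `h` below the vertex `1`. -/
def pairFun (g h : List Bool → List Bool) : List Bool → List Bool
  | [] => []
  | false :: w => false :: g w
  | true :: w => true :: h w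

theorem pairFun_isPrefix_iff (g h : AutT) (u v : List Bool) :
    pairFun g.1 h.1 u <+: pairFun g.1 h.1 v ↔ u <+: v := by
  rcases u with _ | ⟨_ | _, u⟩ <;> rcases v with _ | ⟨_ | _, v⟩ <;>
    simp [pairFun, g.2.2, h.2.2]

/-- The automorphism acting as `p.1` on the subtree at `0` and as `p.2` on the subtree at `1`. -/
def pairAut (p : AutT × AutT) : AutT :=
  ⟨{ toFun := pairFun p.1.1 p.2.1
     invFun := pairFun (p.1⁻¹).1 (p.2⁻¹).1
     left_inv := by
       rintro (_ | ⟨_ | _, w⟩) <;> simp [pairFun]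
     right_inv := by
       rintro (_ | ⟨_ | _, w⟩) <;> simp [pairFun] },
   by rintro (_ | ⟨_ | _, w⟩) <;> simp [pairFun, AutT.length_apply],
   pairFun_isPrefix_iff p.1 p.2⟩

theorem swp_sec_pairAut (p : AutT × AutT) :
    swp (pairAut p) = false ∧ ∀ x, sec (pairAut p) x = cond x p.2 p.1 :=
  swp_sec_of_apply fun x w => by
    change pairFun p.1.1 p.2.1 (x :: w) = _
    cases x <;> simp [pairFun]

/-- `pairAut` as a homomorphism. -/
def pair : AutT × AutT →* AutT where
  toFun := pairAut
  map_one' := AutT.ext_sec (by simp [swp_sec_pairAut]) (by simp [swp_sec_pairAut])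
  map_mul' p q := AutT.ext_sec (by simp [swp_sec_pairAut])
    (by rintro (_ | _) <;> simp [swp_sec_pairAut])

@[simp] theorem swp_pair (p : AutT × AutT) : swp (pair p) = false := (swp_sec_pairAut p).1

@[simp] theorem sec_pair (p : AutT × AutT) (x : Bool) : sec (pair p) x = cond x p.2 p.1 :=
  (swp_sec_pairAut p).2 x

theorem pair_injective : Function.Injective pair := fun p q h =>
  Prod.ext (by simpa using congrArg (sec · false) h) (by simpa using congrArg (sec · true) h)

theorem pair_sec {g : AutT} (hg : swp g = false) : pair (sec g false, sec g true) = g :=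
  AutT.ext_sec (by simp [hg]) (by rintro (_ | _) <;> simp)

/-! ### Level stabilizers -/

theorem mem_levelStab {g : AutT} {m : ℕ} :
    g ∈ levelStab m ↔ ∀ w : List Bool, w.length = m → g.1 w = w := Iff.rfl

theorem levelStab_zero : levelStab 0 = ⊤ :=
  eq_top_iff.2 fun g _ w hw => by
    rw [List.eq_nil_of_length_eq_zero hw, AutT.apply_nil g]

theorem mem_levelStab_succ {g : AutT} {m : ℕ} :
    g ∈ levelStab (m + 1) ↔ swp g = false ∧ ∀ x, sec g x ∈ levelStab m := by
  simp only [mem_levelStab]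
  constructor
  · intro h
    have h1 : ∀ x w, w.length = m → xor x (swp g) = x ∧ (sec g x).1 w = w := fun x w hw => by
      have := h (x :: w) (by simp [hw])
      rw [AutT.apply_cons g] at this
      simpa only [List.cons.injEq] using this
    exact ⟨by simpa using (h1 false (List.replicate m false) (by simp)).1,
      fun x w hw => (h1 x w hw).2⟩
  · rintro ⟨h0, h1⟩ (_ | ⟨x, w⟩) hw
    · simp at hw
    · rw [AutT.apply_cons g, h0, h1 x w (by simpa using hw), Bool.xor_false]

theorem mem_levelStab_one {g : AutT} : g ∈ levelStab 1 ↔ swp g = false := by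
  simp [mem_levelStab_succ (m := 0), levelStab_zero]

instance levelStab_normal (m : ℕ) : (levelStab m).Normal where
  conj_mem g hg h w hw := by
    change h.1 (g.1 ((h⁻¹).1 w)) = w
    rw [hg _ (by rw [AutT.length_apply, hw]), AutT.apply_inv_self]

theorem levelStab_succ_eq_map (m : ℕ) :
    levelStab (m + 1) = ((levelStab m).prod (levelStab m)).map pair := by
  ext g
  rw [mem_levelStab_succ, Subgroup.mem_map]
  constructor
  · rintro ⟨h0, h1⟩
    exact ⟨_, Subgroup.mem_prod.2 ⟨h1 false, h1 true⟩, pair_sec h0⟩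
  · rintro ⟨p, hp, rfl⟩
    obtain ⟨h0, h1⟩ := Subgroup.mem_prod.1 hp
    exact ⟨by simp, by rintro (_ | _) <;> simp [h0, h1]⟩

theorem pair_mem_levelStab_succ {p : AutT × AutT} {m : ℕ} (h1 : p.1 ∈ levelStab m)
    (h2 : p.2 ∈ levelStab m) : pair p ∈ levelStab (m + 1) :=
  mem_levelStab_succ.2 ⟨by simp, by rintro (_ | _) <;> simp [h1, h2]⟩

/-! ### The generators -/

section
variable {B : Type*} [AddCommGroup B] [Module (ZMod 2) B]

/-- The automorphism that a value of `ZMod 2` stands for. -/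
def rootPow (c : ZMod 2) : AutT := if c = 0 then 1 else rootAut

theorem swp_sec_spineAut (ω : ℕ → Module.Dual (ZMod 2) B) (b : B) :
    swp (spineAut ω b) = false ∧
      ∀ x, sec (spineAut ω b) x = cond x (spineAut (shift ω) b) (rootPow (ω 0 b)) :=
  swp_sec_of_apply fun x w => by
    change spineFun ω b (x :: w) = _
    cases x
    · by_cases h : ω 0 b = 0
      · simp [spineFun, h, rootPow]
      · simp only [spineFun, h, rootPow]; rfl
    · simp only [spineFun]; rfl

@[simp] theorem swp_spineAut (ω : ℕ → Module.Dual (ZMod 2) B) (b : B) :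
    swp (spineAut ω b) = false := (swp_sec_spineAut ω b).1

@[simp] theorem sec_spineAut (ω : ℕ → Module.Dual (ZMod 2) B) (b : B) (x : Bool) :
    sec (spineAut ω b) x = cond x (spineAut (shift ω) b) (rootPow (ω 0 b)) :=
  (swp_sec_spineAut ω b).2 x

theorem spineAut_eq_pair (ω : ℕ → Module.Dual (ZMod 2) B) (b : B) :
    spineAut ω b = pair (rootPow (ω 0 b), spineAut (shift ω) b) :=
  AutT.ext_sec (by simp) (by simp)

@[simp] theorem spineAut_mul_self (ω : ℕ → Module.Dual (ZMod 2) B) (b : B) :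
    spineAut ω b * spineAut ω b = 1 := mul_self_autOfInvolutive _ _ _

theorem rootAut_mul_pair_mul_rootAut (p : AutT × AutT) :
    rootAut * pair p * rootAut = pair (p.2, p.1) :=
  AutT.ext_sec (by simp) (by rintro (_ | _) <;> simp)

/-- The value `ω i b` acts at the vertex 1^i 0 of level i + 1, so it moves only words of length at
least i + 2; hence the bound `i + 1 < m`. -/
theorem spineAut_mem_levelStab (ω : ℕ → Module.Dual (ZMod 2) B) (b : B) (m : ℕ)
    (h : ∀ i, i + 1 < m → ω i b = 0) : spineAut ω b ∈ levelStab m := by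
  induction m generalizing ω with
  | zero => simp [levelStab_zero]
  | succ m ih =>
    refine mem_levelStab_succ.2 ⟨by simp, ?_⟩
    rintro (_ | _)
    · rcases m with _ | m
      · simp [levelStab_zero]
      · simp [rootPow, h 0 (by omega)]
    · simpa using ih (shift ω) fun i hi => h (i + 1) (by omega)

end

end Spinal

namespace Spinal

/-! ### Saturated spinal groups -/

section
variable {B : Type*} [AddCommGroup B] [Module (ZMod 2) B]

/-- `G_ω` times the fixator of the `m`-th level. -/
def satGroup (ω : ℕ → Module.Dual (ZMod 2) B) (m : ℕ) : Subgroup AutT :=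
  spinalGroup ω ⊔ levelStab m

variable {ω : ℕ → Module.Dual (ZMod 2) B} {m : ℕ}

theorem rootAut_mem : rootAut ∈ satGroup ω m :=
  Subgroup.mem_sup_left (Subgroup.subset_closure (by simp))

theorem spineAut_mem (b : B) : spineAut ω b ∈ satGroup ω m :=
  Subgroup.mem_sup_left (Subgroup.subset_closure (by simp))

theorem levelStab_le_satGroup : levelStab m ≤ satGroup ω m := le_sup_right

theorem satGroup_eq_closure : satGroup ω m =
    Subgroup.closure ({rootAut} ∪ Set.range (spineAut ω) ∪ (levelStab m : Set AutT)) := by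
  rw [satGroup, spinalGroup, Subgroup.closure_union _ (levelStab m : Set AutT),
    Subgroup.closure_eq]

theorem satGroup_induction {p : (g : AutT) → g ∈ satGroup ω m → Prop}
    (root : p rootAut rootAut_mem) (spine : ∀ b, p (spineAut ω b) (spineAut_mem b))
    (stab : ∀ g (hg : g ∈ levelStab m), p g (levelStab_le_satGroup hg))
    (mul : ∀ g h hg hh, p g hg → p h hh → p (g * h) (mul_mem hg hh))
    (inv : ∀ g hg, p g hg → p g⁻¹ (inv_mem hg)) {g : AutT} (hg : g ∈ satGroup ω m) : p g hg := by
  have key : ∀ (g : AutT)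
      (hg : g ∈ Subgroup.closure ({rootAut} ∪ Set.range (spineAut ω) ∪ (levelStab m : Set AutT))),
      p g (satGroup_eq_closure (ω := ω) (m := m) ▸ hg) := by
    intro g hg
    induction hg using Subgroup.closure_induction with
    | mem x hx =>
      rcases hx with (hx | ⟨b, rfl⟩) | hx
      · obtain rfl : x = rootAut := hx
        exact root
      · exact spine b
      · exact stab x hx
    | one => exact stab 1 (one_mem _)
    | mul x y hx hy h1 h2 => exact mul _ _ _ _ h1 h2
    | inv x hx h => exact inv _ _ h
  exact key g (satGroup_eq_closure (ω := ω) (m := m) ▸ hg)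

theorem rootPow_mem (c : ZMod 2) : rootPow c ∈ satGroup ω m := by
  unfold rootPow; split_ifs
  · exact one_mem _
  · exact rootAut_mem

theorem sec_mem {g : AutT} (hg : g ∈ satGroup ω (m + 1)) (x : Bool) :
    sec g x ∈ satGroup (shift ω) m := by
  induction hg using satGroup_induction generalizing x with
  | root => simp
  | spine b => cases x <;> simp [spineAut_mem, rootPow_mem]
  | stab g hg => exact levelStab_le_satGroup ((mem_levelStab_succ.1 hg).2 x)
  | mul g h _ _ hg hh => rw [sec_mul]; exact mul_mem (hg _) (hh _)
  | inv g _ hg => rw [sec_inv]; exact inv_mem (hg _)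

theorem exists_dual_apply_eq_one {φ : Module.Dual (ZMod 2) B} (h : φ ≠ 0) : ∃ b, φ b = 1 := by
  by_contra! H
  refine h (LinearMap.ext fun b => ?_)
  have := H b
  rw [LinearMap.zero_apply]
  revert this
  generalize φ b = c
  revert c; decide

/-- The generators lift: b@1 is the section of b, and a is the section at 1 of aba as soon as ω₁(b)
= 1. Nothing is claimed about the section at 0. -/
theorem exists_sec_true_eq (hω : ω 0 ≠ 0) {h : AutT} (hh : h ∈ satGroup (shift ω) m) :
    ∃ u ∈ satGroup ω (m + 1), swp u = false ∧ sec u true = h := by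
  induction hh using satGroup_induction with
  | root =>
    obtain ⟨b, hb⟩ := exists_dual_apply_eq_one hω
    exact ⟨rootAut * spineAut ω b * rootAut,
      mul_mem (mul_mem rootAut_mem (spineAut_mem b)) rootAut_mem, by simp, by simp [hb, rootPow]⟩
  | spine b => exact ⟨spineAut ω b, spineAut_mem b, by simp, by simp⟩
  | stab g hg =>
    exact ⟨pair (1, g), levelStab_le_satGroup (pair_mem_levelStab_succ (one_mem _) hg),
      by simp, by simp⟩
  | mul g h _ _ hg hh =>
    obtain ⟨u, hu, hu', rfl⟩ := hg
    obtain ⟨v, hv, hv', rfl⟩ := hh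
    exact ⟨u * v, mul_mem hu hv, by simp [hu', hv'], by simp [hv']⟩
  | inv g _ hg =>
    obtain ⟨u, hu, hu', rfl⟩ := hg
    exact ⟨u⁻¹, inv_mem hu, by simp [hu'], by simp [hu']⟩

/-- The normal closure of `ker φ` in `G_ω`, times the fixator of the `m`-th level. -/
def kerClosure (φ : Module.Dual (ZMod 2) B) (ω : ℕ → Module.Dual (ZMod 2) B) (m : ℕ) :
    Subgroup AutT :=
  Subgroup.closure ({x | ∃ g ∈ satGroup ω m, ∃ b, φ b = 0 ∧ x = g * spineAut ω b * g⁻¹} ∪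
    (levelStab m : Set AutT))

variable {φ : Module.Dual (ZMod 2) B}

theorem levelStab_le_kerClosure : levelStab m ≤ kerClosure φ ω m :=
  fun _ hg => Subgroup.subset_closure (Or.inr hg)

theorem conj_mem_kerClosure {b : B} (hb : φ b = 0) {g : AutT} (hg : g ∈ satGroup ω m) :
    g * spineAut ω b * g⁻¹ ∈ kerClosure φ ω m :=
  Subgroup.subset_closure (Or.inl ⟨g, hg, b, hb, rfl⟩)

theorem spineAut_mem_kerClosure {b : B} (hb : φ b = 0) : spineAut ω b ∈ kerClosure φ ω m := by
  simpa using conj_mem_kerClosure hb (one_mem (satGroup ω m))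

theorem kerClosure_le : kerClosure φ ω m ≤ satGroup ω m := by
  refine (Subgroup.closure_le _).2 ?_
  rintro x (⟨g, hg, b, -, rfl⟩ | hx)
  · exact mul_mem (mul_mem hg (spineAut_mem b)) (inv_mem hg)
  · exact levelStab_le_satGroup hx

theorem kerClosure_conj {n g : AutT} (hn : n ∈ kerClosure φ ω m) (hg : g ∈ satGroup ω m) :
    g * n * g⁻¹ ∈ kerClosure φ ω m := by
  induction hn using Subgroup.closure_induction with
  | mem x hx =>
    rcases hx with ⟨h, hh, b, hb, rfl⟩ | hx
    · simpa [mul_assoc] using conj_mem_kerClosure hb (mul_mem hg hh)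
    · exact levelStab_le_kerClosure ((levelStab_normal m).conj_mem x hx g)
  | one => simp
  | mul x y _ _ hx hy => simpa [mul_assoc] using mul_mem hx hy
  | inv x _ hx => simpa [mul_assoc] using inv_mem hx

instance kerClosure_normal : ((kerClosure φ ω m).subgroupOf (satGroup ω m)).Normal where
  conj_mem _ hn g := kerClosure_conj (Subgroup.mem_subgroupOf.1 hn) g.2

/-- For b in ker ω₁ one has b = ⟨1, b@1⟩, so conjugating by a lift u of h gives ⟨1, h(b@1)h⁻¹⟩
whatever the other section of u is. -/
theorem pair_one_mem_kerClosure (hω : ω 0 ≠ 0) {n : AutT} (hn : n ∈ kerClosure (ω 0) (shift ω) m) :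
    pair (1, n) ∈ kerClosure (ω 0) ω (m + 1) := by
  induction hn using Subgroup.closure_induction with
  | mem x hx =>
    rcases hx with ⟨h, hh, b, hb, rfl⟩ | hx
    · obtain ⟨u, hu, hu', rfl⟩ := exists_sec_true_eq hω hh
      convert conj_mem_kerClosure hb hu using 1
      refine AutT.ext_sec (by simp [hu']) ?_
      rintro (_ | _) <;> simp [hu', hb, rootPow]
    · exact levelStab_le_kerClosure (pair_mem_levelStab_succ (one_mem _) hx)
  | one => exact (map_one pair).symm ▸ one_mem _
  | mul x y _ _ hx hy =>
    have := mul_mem hx hy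
    rwa [← map_mul, Prod.mk_mul_mk, one_mul] at this
  | inv x _ hx =>
    have := inv_mem hx
    rwa [← map_inv, Prod.inv_mk, inv_one] at this

theorem pair_mem_kerClosure (hω : ω 0 ≠ 0) {p : AutT × AutT}
    (h1 : p.1 ∈ kerClosure (ω 0) (shift ω) m) (h2 : p.2 ∈ kerClosure (ω 0) (shift ω) m) :
    pair p ∈ kerClosure (ω 0) ω (m + 1) := by
  have h3 := kerClosure_conj (pair_one_mem_kerClosure hω h1) rootAut_mem
  rw [inv_eq_of_mul_eq_one_left rootAut_mul_self, rootAut_mul_pair_mul_rootAut] at h3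
  have := mul_mem h3 (pair_one_mem_kerClosure hω h2)
  rwa [← map_mul, Prod.mk_mul_mk, one_mul, mul_one] at this

/-! ### Orders of the finite quotients -/

/-- The order of `G_ω mod m`. -/
noncomputable def quoCard (ω : ℕ → Module.Dual (ZMod 2) B) (m : ℕ) : ℕ :=
  (levelStab m).relIndex (satGroup ω m)

theorem nat_card_quo (ω : ℕ → Module.Dual (ZMod 2) B) (m : ℕ) :
    Nat.card (Quo (spinalGroup ω) m) = quoCard ω m :=
  (Subgroup.relIndex_sup_right _ _).symm

theorem quoCard_zero (ω : ℕ → Module.Dual (ZMod 2) B) : quoCard ω 0 = 1 := by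
  rw [quoCard, levelStab_zero]
  exact Subgroup.relIndex_eq_one.2 le_top

theorem relIndex_levelStab_one : (levelStab 1).relIndex (satGroup ω (m + 1)) = 2 := by
  refine Subgroup.relIndex_eq_two_iff.2 ⟨rootAut, rootAut_mem, fun g _ => ?_⟩
  rw [mem_levelStab_one, mem_levelStab_one, swp_mul]
  cases swp g <;> simp

/-- The factor 2 is the action on level one; the rest is an index inside the stabilizer of that
level, transported through the injective `pair`. -/
theorem quoCard_succ {F : Subgroup (AutT × AutT)}
    (hF : ∀ p, p ∈ F ↔ pair p ∈ satGroup ω (m + 1)) :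
    quoCard ω (m + 1) = 2 * ((levelStab m).prod (levelStab m)).relIndex F := by
  have hmap : levelStab 1 ⊓ satGroup ω (m + 1) = F.map pair := by
    ext g
    simp only [Subgroup.mem_inf, mem_levelStab_one, Subgroup.mem_map]
    constructor
    · rintro ⟨h0, h1⟩
      exact ⟨_, (hF _).2 ((pair_sec h0).symm ▸ h1), pair_sec h0⟩
    · rintro ⟨p, hp, rfl⟩
      exact ⟨by simp, (hF p).1 hp⟩
  have hle : levelStab (m + 1) ≤ levelStab 1 := fun g hg =>
    mem_levelStab_one.2 (mem_levelStab_succ.1 hg).1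
  have := Subgroup.relIndex_inf_mul_relIndex (levelStab (m + 1)) (levelStab 1) (satGroup ω (m + 1))
  rw [quoCard, ← inf_eq_left.2 hle, ← this, relIndex_levelStab_one, hmap, levelStab_succ_eq_map,
    Subgroup.relIndex_map_map_of_injective _ _ pair_injective, mul_comm]

theorem relIndex_prod {G G' : Type*} [Group G] [Group G'] (H K : Subgroup G)
    (H' K' : Subgroup G') : (H.prod H').relIndex (K.prod K') = H.relIndex K * H'.relIndex K' := by
  have hinj : Function.Injective (K.subtype.prodMap K'.subtype) :=
    K.subtype_injective.prodMap K'.subtype_injective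
  have h : K.prod K' = (K.subtype.prodMap K'.subtype).range := by
    ext p
    simp only [Subgroup.mem_prod, MonoidHom.mem_range]
    exact ⟨fun h => ⟨(⟨p.1, h.1⟩, ⟨p.2, h.2⟩), rfl⟩, by rintro ⟨q, rfl⟩; exact ⟨q.1.2, q.2.2⟩⟩
  rw [h, ← Subgroup.index_comap, Subgroup.relIndex, Subgroup.relIndex, ← Subgroup.index_prod]
  rfl

theorem quoCard_succ_of_full (h : ∀ g ∈ satGroup (shift ω) m, pair (1, g) ∈ satGroup ω (m + 1)) :
    quoCard ω (m + 1) = 2 * quoCard (shift ω) m ^ 2 := by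
  rw [quoCard_succ (F := (satGroup (shift ω) m).prod (satGroup (shift ω) m)), relIndex_prod,
    ← sq, quoCard]
  intro p
  constructor
  · rintro ⟨h1, h2⟩
    have h3 := mul_mem (mul_mem (rootAut_mem (ω := ω)) (h _ h1)) rootAut_mem
    rw [rootAut_mul_pair_mul_rootAut] at h3
    have := mul_mem h3 (h _ h2)
    rwa [← map_mul, Prod.mk_mul_mk, one_mul, mul_one] at this
  · intro hp
    exact ⟨by simpa using sec_mem hp false, by simpa using sec_mem hp true⟩

/-- The span of the first `m - 1` letters. -/
def letterSpan {V : Type*} [AddCommGroup V] [Module (ZMod 2) V] (ω : ℕ → V) (m : ℕ) :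
    Submodule (ZMod 2) V :=
  Submodule.span (ZMod 2) {φ | ∃ i, i + 1 < m ∧ ω i = φ}

theorem letter_mem_letterSpan {V : Type*} [AddCommGroup V] [Module (ZMod 2) V] {ω : ℕ → V}
    {m i : ℕ} (hi : i + 1 < m) : ω i ∈ letterSpan ω m := Submodule.subset_span ⟨i, hi, rfl⟩

theorem exists_separating [FiniteDimensional (ZMod 2) B]
    {W : Submodule (ZMod 2) (Module.Dual (ZMod 2) B)}
    (h : φ ∉ W) : ∃ b, φ b = 1 ∧ ∀ ψ ∈ W, ψ b = 0 := by
  rw [← Subspace.dualCoannihilator_dualAnnihilator_eq (W := W),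
    Submodule.mem_dualAnnihilator] at h
  push Not at h
  obtain ⟨b, hb, hne⟩ := h
  refine ⟨b, ?_, (Submodule.mem_dualCoannihilator b).1 hb⟩
  revert hne
  generalize φ b = c
  revert c; decide

theorem quoCard_succ_of_notMem [FiniteDimensional (ZMod 2) B]
    (h : ω 0 ∉ letterSpan (shift ω) m) :
    quoCard ω (m + 1) = 2 * quoCard (shift ω) m ^ 2 := by
  obtain ⟨b, hb, hb0⟩ := exists_separating h
  -- This b equals ⟨a, b@1⟩ with b@1 trivial to depth m, so saturation puts ⟨a, 1⟩ itself in the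
  -- group.
  have hs : spineAut (shift ω) b ∈ levelStab m :=
    spineAut_mem_levelStab _ _ _ fun i hi => hb0 _ (letter_mem_letterSpan hi)
  have hroot : pair (rootAut, 1) ∈ satGroup ω (m + 1) := by
    have := mul_mem (spineAut_mem (ω := ω) (m := m + 1) b)
      (inv_mem (levelStab_le_satGroup (ω := ω) (pair_mem_levelStab_succ
        (p := (1, spineAut (shift ω) b)) (one_mem _) hs)))
    rw [spineAut_eq_pair, ← map_inv, ← map_mul] at this
    simpa [rootPow, hb] using this
  have hroot' : pair (1, rootAut) ∈ satGroup ω (m + 1) := by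
    have := mul_mem (mul_mem (rootAut_mem (ω := ω)) hroot) rootAut_mem
    rwa [rootAut_mul_pair_mul_rootAut] at this
  refine quoCard_succ_of_full fun g hg => ?_
  induction hg using satGroup_induction with
  | root => exact hroot'
  -- Dividing c by ⟨ω₁(c), 1⟩, now available, leaves ⟨1, c@1⟩.
  | spine c =>
    have h1 : pair (rootPow (ω 0 c), 1) ∈ satGroup ω (m + 1) := by
      unfold rootPow; split_ifs
      · exact (map_one pair).symm ▸ one_mem _
      · exact hroot
    have := mul_mem (inv_mem h1) (spineAut_mem c)
    rw [spineAut_eq_pair, ← map_inv, ← map_mul] at this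
    simpa using this
  | stab g hg => exact levelStab_le_satGroup (pair_mem_levelStab_succ (one_mem _) hg)
  | mul g h _ _ hg hh =>
    have := mul_mem hg hh
    rwa [← map_mul, Prod.mk_mul_mk, one_mul] at this
  | inv g _ hg =>
    have := inv_mem hg
    rwa [← map_inv, Prod.inv_mk, inv_one] at this

end

end Spinal

namespace Spinal

/-! ### Maps between dihedral groups -/

section
open DihedralGroup

/-- Multiplication by `2` as a map from `ZMod k` to `ZMod (2 * k)`. -/
def dbl (k : ℕ) : ZMod k →+ ZMod (2 * k) :=
  ZMod.lift k ⟨(AddMonoidHom.mulLeft 2).comp (Int.castAddHom (ZMod (2 * k))), by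
    have := ZMod.natCast_self (2 * k)
    push_cast at this
    simpa using this⟩

theorem dbl_intCast (k : ℕ) (z : ℤ) : dbl k z = ((2 * z : ℤ) : ZMod (2 * k)) := by
  simp [dbl]

theorem dbl_one (k : ℕ) : dbl k 1 = 2 := by
  simpa using dbl_intCast k 1

theorem dbl_injective (k : ℕ) : Function.Injective (dbl k) := by
  refine (injective_iff_map_eq_zero _).2 fun x hx => ?_
  obtain ⟨z, rfl⟩ := ZMod.intCast_surjective x
  rw [dbl_intCast, ZMod.intCast_zmod_eq_zero_iff_dvd] at hx
  rw [ZMod.intCast_zmod_eq_zero_iff_dvd]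
  push_cast at hx
  exact (mul_dvd_mul_iff_left two_ne_zero).1 hx

theorem dbl_ne_one (k : ℕ) (x : ZMod k) : dbl k x ≠ 1 := by
  obtain ⟨z, rfl⟩ := ZMod.intCast_surjective x
  rw [dbl_intCast, ← Int.cast_one, Ne, ZMod.intCast_eq_intCast_iff_dvd_sub]
  push_cast
  rintro ⟨c, hc⟩
  have : (1 : ℤ) = 2 * (z + k * c) := by linarith
  omega

/-- The automorphism of the dihedral group exchanging the reflections `sr 0` and `sr 1`. -/
def dihSwap (k : ℕ) : DihedralGroup k →* DihedralGroup k where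
  toFun
    | r i => r (-i)
    | sr i => sr (1 - i)
  map_one' := by rw [one_def]; simp
  map_mul' := by
    rintro (i | i) (j | j) <;> simp <;> ring

@[simp] theorem dihSwap_r {k : ℕ} (i : ZMod k) : dihSwap k (r i) = r (-i) := rfl

@[simp] theorem dihSwap_sr {k : ℕ} (i : ZMod k) : dihSwap k (sr i) = sr (1 - i) := rfl

@[simp] theorem dihSwap_dihSwap {k : ℕ} (d : DihedralGroup k) : dihSwap k (dihSwap k d) = d := by
  cases d <;> simp

/-- The embedding of a dihedral group as a subgroup of index two. -/
def dihEmb (k : ℕ) : DihedralGroup k →* DihedralGroup (2 * k) where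
  toFun
    | r i => r (dbl k i)
    | sr i => sr (dbl k i - 1)
  map_one' := by rw [one_def]; simp
  map_mul' := by
    rintro (i | i) (j | j) <;> simp <;> ring

@[simp] theorem dihEmb_r {k : ℕ} (i : ZMod k) : dihEmb k (r i) = r (dbl k i) := rfl

@[simp] theorem dihEmb_sr {k : ℕ} (i : ZMod k) : dihEmb k (sr i) = sr (dbl k i - 1) := rfl

/-- Inside the larger dihedral group the exchange of the two reflections becomes conjugation by `sr
0`, as conjugation by a exchanges the two sections. -/
theorem dihEmb_dihSwap {k : ℕ} (d : DihedralGroup k) :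
    dihEmb k (dihSwap k d) = sr 0 * dihEmb k d * sr 0 := by
  cases d with
  | r i => simp
  | sr i =>
    simp only [dihSwap_sr, dihEmb_sr, map_sub, dbl_one, sr_mul_sr, sub_zero, r_mul_sr]
    ring_nf

theorem dihEmb_eq_one {k : ℕ} {d : DihedralGroup k} (h : dihEmb k d = 1) : d = 1 := by
  cases d with
  | r i =>
    rw [one_def, dihEmb_r, r.injEq] at h
    rw [one_def, (map_eq_zero_iff _ (dbl_injective k)).1 h]
  | sr i => rw [one_def, dihEmb_sr] at h; cases h

/-- `dihEmb` only produces reflections of odd index, so `sr 0` is outside its image. -/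
theorem sr_zero_mul_dihEmb_ne_one {k : ℕ} (d : DihedralGroup k) : sr 0 * dihEmb k d ≠ 1 := by
  intro h
  cases d with
  | r i => rw [one_def, dihEmb_r, sr_mul_r] at h; cases h
  | sr i =>
    rw [one_def, dihEmb_sr, sr_mul_sr, r.injEq, sub_zero, sub_eq_zero] at h
    exact dbl_ne_one k i h

/-- Two involutions whose product has order dividing `k` define a map from a dihedral group. -/
theorem exists_dihedral_lift {Q : Type*} [Group Q] {k : ℕ} {u v : Q} (hu : u * u = 1)
    (hv : v * v = 1) (huv : (u * v) ^ k = 1) :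
    ∃ e : DihedralGroup k →* Q, e (sr 0) = u ∧ e (sr 1) = v := by
  -- An involution u conjugates uv to vu, its inverse.
  have hconj (z : ℤ) : u * (u * v) ^ z = (u * v) ^ (-z) * u := by
    have hu' : u⁻¹ = u := inv_eq_of_mul_eq_one_left hu
    have hv' : v⁻¹ = v := inv_eq_of_mul_eq_one_left hv
    have : (u * v) ^ (-z) = u * (u * v) ^ z * u⁻¹ := by
      rw [← conj_zpow, zpow_neg, ← inv_zpow, mul_inv_rev, hu', hv']
      congr 1
      rw [← mul_assoc, hu, one_mul]
    rw [this, inv_mul_cancel_right]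
  let ρ : Multiplicative (ZMod k) →* Q :=
    AddMonoidHom.toMultiplicativeLeft (ZMod.lift k
      ⟨MonoidHom.toAdditiveRight (zpowersHom Q (u * v)), by simp [huv]⟩)
  have hρ (z : ℤ) : ρ (Multiplicative.ofAdd (z : ZMod k)) = (u * v) ^ z := by
    simp [ρ]
  have hρadd (i j : ZMod k) : ρ (Multiplicative.ofAdd (i + j)) =
      ρ (Multiplicative.ofAdd i) * ρ (Multiplicative.ofAdd j) := by
    rw [ofAdd_add, map_mul]
  have hcomm (i : ZMod k) : u * ρ (Multiplicative.ofAdd i) = ρ (Multiplicative.ofAdd (-i)) * u := by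
    obtain ⟨z, rfl⟩ := ZMod.intCast_surjective i
    rw [← Int.cast_neg, hρ, hρ, hconj]
  refine ⟨
    { toFun := fun d => match d with
        | r i => ρ (Multiplicative.ofAdd i)
        | sr i => u * ρ (Multiplicative.ofAdd i)
      map_one' := by rw [one_def]; exact map_one ρ
      map_mul' := ?_ }, ?_, ?_⟩
  · rintro (i | i) (j | j)
    · exact hρadd i j
    · change u * ρ (Multiplicative.ofAdd (j - i)) =
        ρ (Multiplicative.ofAdd i) * (u * ρ (Multiplicative.ofAdd j))
      rw [hcomm, hcomm, ← mul_assoc, ← hρadd, neg_sub, sub_eq_add_neg]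
    · change u * ρ (Multiplicative.ofAdd (i + j)) = _
      rw [hρadd, ← mul_assoc]
    · change ρ (Multiplicative.ofAdd (j - i)) =
        u * ρ (Multiplicative.ofAdd i) * (u * ρ (Multiplicative.ofAdd j))
      rw [hcomm i, mul_assoc, ← mul_assoc u u, hu, one_mul, ← hρadd, neg_add_eq_sub]
  · change u * ρ 1 = u
    rw [map_one, mul_one]
  · change u * ρ (Multiplicative.ofAdd 1) = v
    have := hρ 1
    rw [Int.cast_one, zpow_one] at this
    rw [this, ← mul_assoc, hu, one_mul]

end

/-! ### Dihedral quotients of spinal groups -/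

section
open DihedralGroup
variable {B : Type*} [AddCommGroup B] [Module (ZMod 2) B]

/-- `G_ω mod m` modulo the normal closure of `ker φ` is dihedral of order `2 * k`. -/
structure DihedralQuotient (φ : Module.Dual (ZMod 2) B) (ω : ℕ → Module.Dual (ZMod 2) B)
    (m k : ℕ) where
  /-- The quotient map. -/
  f : satGroup ω m →* DihedralGroup k
  root : f ⟨rootAut, rootAut_mem⟩ = sr 0
  spine : ∀ b, f ⟨spineAut ω b, spineAut_mem b⟩ = if φ b = 0 then 1 else sr 1
  stab : ∀ g (hg : g ∈ levelStab m), f ⟨g, levelStab_le_satGroup hg⟩ = 1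
  ker : ∀ g, f g = 1 → g.1 ∈ kerClosure φ ω m

variable {ω : ℕ → Module.Dual (ZMod 2) B} {m k : ℕ} {φ : Module.Dual (ZMod 2) B}

namespace DihedralQuotient

theorem f_surjective (D : DihedralQuotient φ ω m k) (hφ : φ ≠ 0) : Function.Surjective D.f := by
  obtain ⟨b, hb⟩ := exists_dual_apply_eq_one hφ
  have h0 : sr 0 ∈ D.f.range := ⟨_, D.root⟩
  have h1 : sr 1 ∈ D.f.range := ⟨_, by rw [D.spine b, hb]; simp⟩
  have h2 : (r 1 : DihedralGroup k) ∈ D.f.range := by simpa using mul_mem h0 h1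
  have hr (i : ZMod k) : r i ∈ D.f.range := by
    obtain ⟨z, rfl⟩ := ZMod.intCast_surjective i
    simpa using zpow_mem h2 z
  rw [← MonoidHom.range_eq_top, eq_top_iff]
  rintro (i | i) -
  · exact hr i
  · simpa using mul_mem h0 (hr i)

theorem map_rootPow (D : DihedralQuotient φ ω m k) (c : ZMod 2) :
    D.f ⟨rootPow c, rootPow_mem c⟩ = if c = 0 then 1 else sr 0 := by
  by_cases h : c = 0
  · subst h
    rw [if_pos rfl]
    exact map_one D.f
  · rw [if_neg h, ← D.root]
    congr 2
    simp [rootPow, h]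

/-- On b the two sections are ω₁(b) and b@1, sent to `sr 0` and `sr 1` if ω₁(b) ≠ 0 and both to 1
otherwise. The relation survives products because the exchange is an involution. -/
theorem sec_false (D : DihedralQuotient (ω 0) (shift ω) m k) {g : AutT}
    (hg : g ∈ satGroup ω (m + 1)) :
    D.f ⟨sec g false, sec_mem hg _⟩ = dihSwap k (D.f ⟨sec g true, sec_mem hg _⟩) := by
  induction hg using satGroup_induction with
  | root =>
    simp only [sec_rootAut]
    exact (map_one D.f).trans ((congrArg _ (map_one D.f)).trans (map_one _)).symm
  | spine b =>
    simp only [sec_spineAut, cond_true, cond_false]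
    rw [D.spine, D.map_rootPow]
    split_ifs <;> simp
  | stab g hg =>
    rw [D.stab _ ((mem_levelStab_succ.1 hg).2 _), D.stab _ ((mem_levelStab_succ.1 hg).2 _),
      map_one]
  | mul g h hg hh h1 h2 =>
    have key (x : Bool) : D.f ⟨sec (g * h) x, sec_mem (mul_mem hg hh) _⟩ =
        D.f ⟨sec g (xor x (swp h)), sec_mem hg _⟩ * D.f ⟨sec h x, sec_mem hh _⟩ := by
      rw [← map_mul]; congr 2; exact sec_mul g h x
    rw [key, key, map_mul, h2]
    cases swp h
    · simpa using h1
    · simp [h1]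
  | inv g hg h1 =>
    have key (x : Bool) : D.f ⟨sec g⁻¹ x, sec_mem (inv_mem hg) _⟩ =
        (D.f ⟨sec g (xor x (swp g)), sec_mem hg _⟩)⁻¹ := by
      rw [← map_inv]; congr 2; exact sec_inv g x
    rw [key, key, map_inv]
    cases swp g
    · simpa using h1
    · simp [h1]

/-- The dihedral quotient one level deeper. -/
noncomputable def extend (hω : ω 0 ≠ 0) (D : DihedralQuotient (ω 0) (shift ω) m k) :
    DihedralQuotient (ω 0) ω (m + 1) (2 * k) where
  f :=
    -- The section at 1 suffices, since it determines the image of the section at 0. The embedding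
    -- sends `sr 1` to `sr 1`, the value of b, and `sr 0` to `sr (-1)`, the value of aba.
    { toFun := fun g => (cond (swp g.1) (sr 0) 1) * dihEmb k (D.f ⟨sec g.1 true, sec_mem g.2 _⟩)
      map_one' := by
        simp only [Subgroup.coe_one, swp_one, cond_false, sec_one, one_mul]
        exact (congrArg _ (map_one D.f)).trans (map_one _)
      map_mul' := fun g h => by
        have key : D.f ⟨sec (g * h).1 true, sec_mem (g * h).2 _⟩ =
            D.f ⟨sec g.1 (xor true (swp h.1)), sec_mem g.2 _⟩ *
              D.f ⟨sec h.1 true, sec_mem h.2 _⟩ := by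
          rw [← map_mul]; congr 2; exact sec_mul g.1 h.1 true
        rw [key]
        simp only [Subgroup.coe_mul, swp_mul]
        have h0 : (sr 0 : DihedralGroup (2 * k)) * sr 0 = 1 := sr_mul_self 0
        cases hh : swp h.1 <;> cases hg : swp g.1
        · simp
        · simp [mul_assoc]
        · simp only [Bool.xor_false, Bool.xor_true, Bool.not_true, cond_true, cond_false, one_mul,
            map_mul, D.sec_false g.2, dihEmb_dihSwap, mul_assoc]
          rw [← mul_assoc (sr 0) (sr 0), h0, one_mul]
        · simp [D.sec_false g.2, dihEmb_dihSwap, mul_assoc] }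
  root := by
    simp only [MonoidHom.coe_mk, OneHom.coe_mk, swp_rootAut, cond_true, sec_rootAut]
    exact (congrArg _ ((congrArg _ (map_one D.f)).trans (map_one _))).trans (mul_one _)
  spine b := by
    simp only [MonoidHom.coe_mk, OneHom.coe_mk, swp_spineAut, cond_false, sec_spineAut, cond_true,
      one_mul]
    rw [D.spine]
    split_ifs
    · exact map_one _
    · rw [dihEmb_sr, dbl_one]; norm_num
  stab g hg := by
    simp only [MonoidHom.coe_mk, OneHom.coe_mk, (mem_levelStab_succ.1 hg).1, cond_false, one_mul]
    rw [D.stab _ ((mem_levelStab_succ.1 hg).2 _), map_one]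
  ker g hg := by
    simp only [MonoidHom.coe_mk, OneHom.coe_mk] at hg
    cases hs : swp g.1
    -- Both sections lie in the kernel one level up, and pairs of elements of that normal closure
    -- lie in the new one.
    · rw [hs, cond_false, one_mul] at hg
      have h1 := dihEmb_eq_one hg
      have h0 := D.sec_false g.2
      rw [h1, map_one] at h0
      rw [← pair_sec hs]
      exact pair_mem_kerClosure hω (D.ker _ h0) (D.ker _ h1)
    · rw [hs, cond_true] at hg
      exact absurd hg (sr_zero_mul_dihEmb_ne_one _)

end DihedralQuotient

theorem quoCard_succ_mul (hω : ω 0 ≠ 0) (D : DihedralQuotient (ω 0) (shift ω) m k) [NeZero k] :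
    quoCard ω (m + 1) * (2 * k) = 2 * quoCard (shift ω) m ^ 2 := by
  let H := satGroup (shift ω) m
  let R : Subgroup (DihedralGroup k × DihedralGroup k) :=
    { carrier := {p | p.1 = dihSwap k p.2}
      mul_mem' := fun {p q} hp hq => by
        change p.1 * q.1 = dihSwap k (p.2 * q.2)
        rw [map_mul, ← hp, ← hq]
      one_mem' := (map_one _).symm
      inv_mem' := fun {p} hp => by
        change p.1⁻¹ = dihSwap k p.2⁻¹
        rw [map_inv, ← hp] }
  let F₀ : Subgroup (H × H) := R.comap (D.f.prodMap D.f)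
  let ι : H × H →* AutT × AutT := H.subtype.prodMap H.subtype
  have hι : Function.Injective ι := H.subtype_injective.prodMap H.subtype_injective
  have htop : (⊤ : Subgroup (H × H)).map ι = H.prod H := by
    ext p
    simp only [Subgroup.mem_prod, Subgroup.mem_map, Subgroup.mem_top, true_and]
    exact ⟨by rintro ⟨q, rfl⟩; exact ⟨q.1.2, q.2.2⟩, fun h => ⟨(⟨p.1, h.1⟩, ⟨p.2, h.2⟩), rfl⟩⟩
  have hF : ∀ p, p ∈ F₀.map ι ↔ pair p ∈ satGroup ω (m + 1) := by
    rintro ⟨g, h⟩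
    constructor
    · rintro ⟨⟨g, h⟩, hgh, heq⟩
      obtain ⟨rfl, rfl⟩ := Prod.mk.inj heq
      replace hgh : D.f g = dihSwap k (D.f h) := hgh
      -- Lift h to u fixing level one. The section of u at 0 agrees with g in the dihedral quotient,
      -- so they differ by n in the normal closure, and ⟨n, 1⟩ lies in the group.
      obtain ⟨u, hu, hu', hh⟩ := exists_sec_true_eq (ω := ω) hω h.2
      have h0 := D.sec_false hu
      simp only [hh] at h0
      have h1 : g.1 * (sec u false)⁻¹ ∈ kerClosure (ω 0) (shift ω) m :=
        D.ker (g * ⟨sec u false, sec_mem hu _⟩⁻¹) (by rw [map_mul, map_inv, h0, hgh, mul_inv_cancel])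
      have h2 := mul_mem (kerClosure_le (pair_mem_kerClosure (p := (_, 1)) hω h1 (one_mem _))) hu
      have h3 := pair_sec hu'
      rw [hh] at h3
      rw [← h3, ← map_mul] at h2
      simpa using h2
    · intro hp
      have h1 : g ∈ H := by simpa using sec_mem hp false
      have h2 : h ∈ H := by simpa using sec_mem hp true
      refine ⟨(⟨g, h1⟩, ⟨h, h2⟩), ?_, rfl⟩
      have := D.sec_false hp
      simp only [sec_pair, cond_true, cond_false] at this
      exact this
  have hindex : (F₀.map ι).relIndex (H.prod H) = 2 * k := by
    rw [← htop, Subgroup.relIndex_map_map_of_injective _ _ hι, Subgroup.relIndex_top_right,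
      Subgroup.index_comap_of_surjective _
        ((D.f_surjective hω).prodMap (D.f_surjective hω))]
    -- R is the graph of the exchange: it has 2k elements among (2k)², hence index 2k.
    have hcard : Nat.card R = 2 * k := by
      rw [← nat_card]
      exact Nat.card_congr
        { toFun := fun p => p.1.2
          invFun := fun d => ⟨(dihSwap k d, d), rfl⟩
          left_inv := fun p => Subtype.ext (Prod.ext p.2.symm rfl)
          right_inv := fun d => rfl }
    have := R.card_mul_index
    rw [hcard, Nat.card_prod, nat_card] at this
    exact Nat.eq_of_mul_eq_mul_left (Nat.pos_of_ne_zero (by simp [NeZero.ne k])) this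
  have hle : (levelStab m).prod (levelStab m) ≤ F₀.map ι := fun p hp =>
    (hF p).2 (levelStab_le_satGroup (pair_mem_levelStab_succ hp.1 hp.2))
  have hle' : F₀.map ι ≤ H.prod H := htop ▸ Subgroup.map_mono le_top
  rw [quoCard_succ hF, mul_assoc, ← hindex, Subgroup.relIndex_mul_relIndex _ _ _ hle hle',
    relIndex_prod, ← sq, quoCard]

end

end Spinal

namespace Spinal

/-! ### Level parities -/

section
open DihedralGroup
variable {B : Type*} [AddCommGroup B] [Module (ZMod 2) B]

/-- The parity of the number of vertices of level `j` at which `g` exchanges the subtrees. -/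
def levelParity : ℕ → AutT → ZMod 2
  | 0, g => cond (swp g) 1 0
  | j + 1, g => levelParity j (sec g false) + levelParity j (sec g true)

theorem levelParity_mul (j : ℕ) (g h : AutT) :
    levelParity j (g * h) = levelParity j g + levelParity j h := by
  induction j generalizing g h with
  | zero =>
    simp only [levelParity, swp_mul]
    cases swp g <;> cases swp h <;> decide
  | succ j ih =>
    simp only [levelParity, sec_mul, ih]
    cases swp h <;> simp <;> ring

theorem levelParity_one (j : ℕ) : levelParity j 1 = 0 := by
  simpa using levelParity_mul j 1 1

theorem levelParity_eq_zero {j m : ℕ} (hj : j < m) {g : AutT} (hg : g ∈ levelStab m) :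
    levelParity j g = 0 := by
  induction j generalizing m g with
  | zero =>
    obtain ⟨m, rfl⟩ := Nat.exists_eq_add_of_lt hj
    rw [zero_add] at hg
    simp [levelParity, (mem_levelStab_succ.1 hg).1]
  | succ j ih =>
    obtain ⟨m, rfl⟩ := Nat.exists_eq_add_of_lt hj
    have := (mem_levelStab_succ.1 hg).2
    simp [levelParity, ih (by omega) (this _)]

theorem levelParity_rootAut (j : ℕ) : levelParity j rootAut = if j = 0 then 1 else 0 := by
  cases j <;> simp [levelParity, levelParity_one]

theorem levelParity_spineAut_zero (ω : ℕ → Module.Dual (ZMod 2) B) (b : B) :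
    levelParity 0 (spineAut ω b) = 0 := by
  simp [levelParity]

theorem levelParity_spineAut (ω : ℕ → Module.Dual (ZMod 2) B) (b : B) (j : ℕ) :
    levelParity (j + 1) (spineAut ω b) = ω j b := by
  induction j generalizing ω with
  | zero =>
    simp only [levelParity, sec_spineAut, cond_true, cond_false, swp_spineAut, add_zero]
    generalize ω 0 b = c
    by_cases hc : c = 0
    · simp [rootPow, hc]
    · simp only [rootPow, if_neg hc, swp_rootAut, cond_true]
      revert hc; revert c; decide
  | succ j ih =>
    rw [levelParity, sec_spineAut, sec_spineAut, cond_true, cond_false, ih]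
    have : levelParity (j + 1) (rootPow (ω 0 b)) = 0 := by
      unfold rootPow; split_ifs
      · exact levelParity_one _
      · simp [levelParity_rootAut]
    rw [this, zero_add]; rfl

/-- The parity at level i + 1 is ω_{i+1} on B and 0 on a; at level 0 it is 0 on B and 1 on a. Linear
combinations realize every ψ in the span together with any value on a. -/
theorem exists_parity {ω : ℕ → Module.Dual (ZMod 2) B} {m : ℕ} (hm : 0 < m)
    {ψ : Module.Dual (ZMod 2) B} (hψ : ψ ∈ letterSpan ω m) (c : ZMod 2) :
    ∃ p : AutT → ZMod 2, (∀ g h, p (g * h) = p g + p h) ∧ (∀ g ∈ levelStab m, p g = 0) ∧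
      p rootAut = c ∧ ∀ b, p (spineAut ω b) = ψ b := by
  induction hψ using Submodule.span_induction generalizing c with
  | mem ψ h =>
    obtain ⟨i, hi, rfl⟩ := h
    refine ⟨fun g => levelParity (i + 1) g + c * levelParity 0 g, fun g h => ?_, fun g hg => ?_,
      ?_, fun b => ?_⟩
    · beta_reduce; rw [levelParity_mul, levelParity_mul]; ring
    · beta_reduce; rw [levelParity_eq_zero hi hg, levelParity_eq_zero hm hg]; simp
    · simp [levelParity_rootAut]
    · beta_reduce; rw [levelParity_spineAut, levelParity_spineAut_zero, mul_zero, add_zero]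
  | zero =>
    refine ⟨fun g => c * levelParity 0 g, fun g h => ?_, fun g hg => ?_, ?_, fun b => ?_⟩
    · beta_reduce; rw [levelParity_mul]; ring
    · beta_reduce; rw [levelParity_eq_zero hm hg]; simp
    · simp [levelParity_rootAut]
    · beta_reduce; rw [levelParity_spineAut_zero]; simp
  | add φ ψ _ _ h1 h2 =>
    obtain ⟨p, hp, hp', hpr, hps⟩ := h1 c
    obtain ⟨q, hq, hq', hqr, hqs⟩ := h2 0
    refine ⟨fun g => p g + q g, fun g h => ?_, fun g hg => ?_, ?_, fun b => ?_⟩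
    · beta_reduce; rw [hp, hq]; ring
    · beta_reduce; rw [hp' g hg, hq' g hg, add_zero]
    · beta_reduce; rw [hpr, hqr, add_zero]
    · beta_reduce; rw [hps, hqs]; rfl
  | smul d φ _ h1 =>
    obtain ⟨p, hp, hp', hpr, hps⟩ := h1 0
    refine ⟨fun g => d * p g + c * levelParity 0 g, fun g h => ?_, fun g hg => ?_, ?_,
      fun b => ?_⟩
    · beta_reduce; rw [hp, levelParity_mul]; ring
    · beta_reduce; rw [hp' g hg, levelParity_eq_zero hm hg]; simp
    · beta_reduce; rw [hpr]; simp [levelParity_rootAut]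
    · beta_reduce; rw [hps, levelParity_spineAut_zero]; simp

/-! ### Dihedral quotients of order eight -/

/-- The element of the dihedral group of order eight with swap `s`, whose components at `0` and `1`
are `u` and `v`. -/
def dihFourElt (s : Bool) (u v : ZMod 2) : DihedralGroup 4 :=
  cond s (sr 0) 1 * (if v = 0 then 1 else sr 1) * (if u = 0 then 1 else sr 3)

/-- The dihedral group of order eight is the wreath product of two groups of order two; its base is
generated by the commuting reflections `sr 1` and `sr 3 = sr 0 * sr 1 * sr 0`. -/
theorem dihFourElt_mul (s t : Bool) (u v u' v' : ZMod 2) :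
    dihFourElt (xor t s) (cond t v u + u') (cond t u v + v') =
      dihFourElt s u v * dihFourElt t u' v' := by
  revert s t u v u' v'
  decide

/-- The map to the dihedral group of order eight defined by a parity of the sections at the first
level, twisted by a parity. -/
def dihFourHom (p q : AutT → ZMod 2) (hp : ∀ g h, p (g * h) = p g + p h)
    (hq : ∀ g h, q (g * h) = q g + q h) : AutT →* DihedralGroup 4 :=
  MonoidHom.mk' (fun g => dihFourElt (swp g) (p (sec g false) + q g) (p (sec g true) + q g))
    fun g h => by
      rw [← dihFourElt_mul, swp_mul, sec_mul, sec_mul, hp, hp, hq]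
      cases swp h
      · simp only [Bool.xor_false, cond_false]
        congr 1 <;> ring
      · simp only [Bool.xor_true, cond_true, Bool.not_true, Bool.not_false]
        congr 1 <;> ring

variable {ω : ℕ → Module.Dual (ZMod 2) B} {m : ℕ} {φ : Module.Dual (ZMod 2) B}

theorem exists_add_mem_letterSpan_shift (h : φ ∈ letterSpan ω (m + 1)) :
    ∃ c : ZMod 2, φ + c • ω 0 ∈ letterSpan (shift ω) m := by
  have hsub : {ψ | ∃ i, i + 1 < m + 1 ∧ ω i = ψ} ⊆
      insert (ω 0) {ψ | ∃ i, i + 1 < m ∧ shift ω i = ψ} := by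
    rintro _ ⟨_ | i, hi, rfl⟩
    · exact Or.inl rfl
    · exact Or.inr ⟨i, by omega, rfl⟩
  obtain ⟨c, ψ, hψ, rfl⟩ := Submodule.mem_span_insert.1 (Submodule.span_mono hsub h)
  refine ⟨c, ?_⟩
  rw [add_right_comm, ← add_smul, CharTwo.add_self_eq_zero, zero_smul, zero_add]
  exact hψ

theorem letterSpan_eq_bot {V : Type*} [AddCommGroup V] [Module (ZMod 2) V] (ω : ℕ → V)
    (hm : m ≤ 1) : letterSpan ω m = ⊥ := by
  have : {ψ | ∃ i, i + 1 < m ∧ ω i = ψ} = ∅ := by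
    refine Set.eq_empty_of_forall_notMem ?_
    rintro _ ⟨i, hi, -⟩
    omega
  rw [letterSpan, this, Submodule.span_empty]

theorem one_lt_of_mem_letterSpan (hφ : φ ≠ 0) (h : φ ∈ letterSpan ω m) : 1 < m := by
  by_contra hm
  rw [letterSpan_eq_bot ω (by omega), Submodule.mem_bot] at h
  exact hφ h

/-- This bounds the quotient from below. Writing φ + cω₁ in terms of the later letters gives a
parity p of sections; adding the parity q, equal to cω₁ on B, makes the components of b equal to 0
and φ(b). -/
theorem exists_dihFourHom (hφ : φ ≠ 0) (h : φ ∈ letterSpan ω m) :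
    ∃ f : AutT →* DihedralGroup 4, f rootAut = sr 0 ∧
      (∀ b, f (spineAut ω b) = if φ b = 0 then 1 else sr 1) ∧ ∀ g ∈ levelStab m, f g = 1 := by
  have hm : 1 < m := one_lt_of_mem_letterSpan hφ h
  obtain ⟨m, rfl⟩ : ∃ k, m = k + 1 := ⟨m - 1, by omega⟩
  obtain ⟨c, hc⟩ := exists_add_mem_letterSpan_shift h
  obtain ⟨p, hp, hp', hpr, hps⟩ := exists_parity (by omega) hc c
  obtain ⟨q, hq, hq', hqr, hqs⟩ := exists_parity (by omega)
    (Submodule.smul_mem _ c (letter_mem_letterSpan (ω := ω) (i := 0) hm)) 0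
  have hp1 : p 1 = 0 := by simpa using hp 1 1
  refine ⟨dihFourHom p q hp hq, ?_, fun b => ?_, fun g hg => ?_⟩
  · simp [dihFourHom, dihFourElt, hp1, hqr]
  · have h1 : p (rootPow (ω 0 b)) + (c • ω 0) b = 0 := by
      rw [LinearMap.smul_apply, smul_eq_mul]
      generalize ω 0 b = d
      by_cases hd : d = 0
      · simp [rootPow, hd, hp1]
      · rw [rootPow, if_neg hd, hpr]
        clear * - hd
        revert c d; decide
    simp only [dihFourHom, MonoidHom.mk'_apply, swp_spineAut, sec_spineAut, cond_true, cond_false,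
      hps, hqs, h1]
    have h2 : (φ + c • ω 0) b + (c • ω 0) b = φ b := by
      rw [LinearMap.add_apply, add_assoc, CharTwo.add_self_eq_zero, add_zero]
    rw [h2]
    simp [dihFourElt]
  · have h1 := mem_levelStab_succ.1 hg
    simp [dihFourHom, dihFourElt, h1.1, hp' _ (h1.2 _), hq' g hg]

theorem spineAut_mul (b b' : B) : spineAut ω b * spineAut ω b' = spineAut ω (b + b') := by
  refine AutT.ext fun w => ?_
  change spineFun ω b (spineFun ω b' w) = spineFun ω (b + b') w
  induction w generalizing ω with
  | nil => simp [spineFun]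
  | cons x w ih =>
    cases x
    · simp only [spineFun, map_add]
      have key : ∀ c d : ZMod 2, (if c = 0 then (if d = 0 then w else rootFun w)
          else rootFun (if d = 0 then w else rootFun w)) =
          if c + d = 0 then w else rootFun w := by
        intro c d
        have hw := rootFun_involutive w
        have : (c = 0 ∨ c = 1) ∧ (d = 0 ∨ d = 1) := by revert c d; decide
        rcases this with ⟨rfl | rfl, rfl | rfl⟩ <;> simp [hw, CharTwo.add_self_eq_zero]
      rw [key]
    · simp only [spineFun, ih]

/-- A homomorphism with the right values on generators is a dihedral quotient as soon as the
product of two generating involutions has the right order. -/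
theorem nonempty_dihedralQuotient {k : ℕ} (f : AutT →* DihedralGroup k) (hroot : f rootAut = sr 0)
    (hspine : ∀ b, f (spineAut ω b) = if φ b = 0 then 1 else sr 1)
    (hstab : ∀ g ∈ levelStab m, f g = 1) {b : B} (hb : φ b = 1)
    (hpow : (rootAut * spineAut ω b) ^ k ∈ kerClosure φ ω m) :
    Nonempty (DihedralQuotient φ ω m k) := by
  let H := satGroup ω m
  let N := (kerClosure φ ω m).subgroupOf H
  let a' : H := ⟨rootAut, rootAut_mem⟩
  let b' : H := ⟨spineAut ω b, spineAut_mem b⟩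
  have hmk {x : H} (hx : x.1 ∈ kerClosure φ ω m) : QuotientGroup.mk' N x = 1 :=
    (QuotientGroup.eq_one_iff x).2 hx
  obtain ⟨e, he0, he1⟩ := exists_dihedral_lift (k := k) (u := QuotientGroup.mk' N a')
    (v := QuotientGroup.mk' N b')
    (by rw [← map_mul, ← map_one (QuotientGroup.mk' N)]
        exact congrArg _ (Subtype.ext rootAut_mul_self))
    (by rw [← map_mul, ← map_one (QuotientGroup.mk' N)]
        exact congrArg _ (Subtype.ext (spineAut_mul_self ω b)))
    (by rw [← map_mul, ← map_pow]; exact hmk hpow)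
  -- The lift e inverts f modulo the normal closure: e ∘ f is the quotient map, so ker f lies in the
  -- closure. All c with φ(c) = 1 have the same class as b, because b + c is in ker φ.
  have key {g : AutT} (hg : g ∈ H) : e (f g) = QuotientGroup.mk' N ⟨g, hg⟩ := by
    induction hg using satGroup_induction with
    | root => rw [hroot, he0]
    | spine c =>
      rw [hspine]
      split_ifs with hc
      · rw [map_one]
        exact (hmk (spineAut_mem_kerClosure hc)).symm
      · have hc1 : φ c = 1 := by
          revert hc
          generalize φ c = d
          revert d; decide
        have hbc : φ (b + c) = 0 := by rw [map_add, hb, hc1]; decide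
        rw [he1, ← mul_inv_eq_one, ← map_inv, ← map_mul]
        refine hmk ?_
        change spineAut ω b * (spineAut ω c)⁻¹ ∈ _
        rw [inv_eq_of_mul_eq_one_left (spineAut_mul_self ω c), spineAut_mul]
        exact spineAut_mem_kerClosure hbc
    | stab g hg =>
      rw [hstab g hg, map_one]
      exact (hmk (levelStab_le_kerClosure hg)).symm
    | mul g h hg hh h1 h2 => rw [map_mul, map_mul, h1, h2]; rfl
    | inv g hg h1 => rw [map_inv, map_inv, h1]; rfl
  exact ⟨{
    f := f.comp H.subtype
    root := hroot
    spine := hspine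
    stab := hstab
    ker := fun g hg => by
      have := key g.2
      rw [show f g.1 = 1 from hg, map_one] at this
      exact (QuotientGroup.eq_one_iff g).1 this.symm }⟩

theorem nonempty_dihedralQuotient_four [FiniteDimensional (ZMod 2) B] (hφ : φ ≠ 0)
    (h : φ ∈ letterSpan ω (m + 1)) (h' : φ = ω 0 → φ ∉ letterSpan (shift ω) m) :
    Nonempty (DihedralQuotient φ ω (m + 1) 4) := by
  obtain ⟨f, hroot, hspine, hstab⟩ := exists_dihFourHom hφ h
  by_cases heq : φ = ω 0
  -- Here b acts as ⟨a, 1⟩ up to depth m + 1, and (ab)⁴ is trivial there.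
  · obtain ⟨b, hb, hb0⟩ := exists_separating (h' heq)
    refine nonempty_dihedralQuotient f hroot hspine hstab hb (levelStab_le_kerClosure ?_)
    have hs : spineAut (shift ω) b ∈ levelStab m :=
      spineAut_mem_levelStab _ _ _ fun i hi => hb0 _ (letter_mem_letterSpan hi)
    have hc : rootAut * spineAut (shift ω) b * rootAut ∈ levelStab m := by
      have := (levelStab_normal m).conj_mem _ hs rootAut
      rwa [inv_eq_of_mul_eq_one_left rootAut_mul_self] at this
    have h0 : ω 0 b = 1 := heq ▸ hb
    refine mem_levelStab_succ.2 ⟨by simp [pow_succ], ?_⟩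
    rintro (_ | _)
    · simpa [pow_succ, h0, rootPow, mul_assoc] using mul_mem hs hc
    · simpa [pow_succ, h0, rootPow, mul_assoc] using mul_mem hc hs
  -- Over Z/2 a nonzero φ different from ω₁ is not in its span. Some b with φ(b) = 1 then has ω₁(b)
  -- = 0, so b = ⟨1, b@1⟩ and (ab)⁴ = 1 exactly.
  · have hn : φ ∉ Submodule.span (ZMod 2) {ω 0} := by
      rw [Submodule.mem_span_singleton]
      rintro ⟨c, hc⟩
      have : c = 0 ∨ c = 1 := by clear hc; revert c; decide
      rcases this with rfl | rfl
      · exact hφ (by rw [← hc, zero_smul])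
      · exact heq (by rw [← hc, one_smul])
    obtain ⟨b, hb, hb0⟩ := exists_separating hn
    have h0 := hb0 _ (Submodule.mem_span_singleton_self _)
    refine nonempty_dihedralQuotient f hroot hspine hstab hb ?_
    rw [show (rootAut * spineAut ω b) ^ 4 = 1 from ?_]
    · exact one_mem _
    refine AutT.ext_sec (by simp [pow_succ]) ?_
    rintro (_ | _) <;> simp [pow_succ, h0, rootPow]

end

end Spinal

namespace Spinal

/-! ### Recursion over the first syllable -/

theorem shift_iterate_apply {V : Type*} (ω : ℕ → V) (r i : ℕ) : shift^[r] ω i = ω (r + i) := by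
  induction r generalizing ω with
  | zero => simp
  | succ r ih => rw [Function.iterate_succ_apply, ih, shift, add_right_comm]

theorem shift_ne_zero {V : Type*} [Zero V] {ω : ℕ → V} (hω : ∀ i, ω i ≠ 0) (i : ℕ) :
    shift ω i ≠ 0 := hω (i + 1)

theorem shift_iterate_ne_zero {V : Type*} [Zero V] {ω : ℕ → V} (hω : ∀ i, ω i ≠ 0) (r i : ℕ) :
    shift^[r] ω i ≠ 0 := shift_iterate_apply ω r i ▸ hω _

section
variable {B : Type*} [AddCommGroup B] [Module (ZMod 2) B] [FiniteDimensional (ZMod 2) B]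
  {ω : ℕ → Module.Dual (ZMod 2) B} {φ : Module.Dual (ZMod 2) B}

theorem exists_dihedralQuotient (hω : ∀ i, ω i ≠ 0) (hφ : φ ≠ 0) {m : ℕ}
    (h : φ ∈ letterSpan ω m) : ∃ k, k ≠ 0 ∧ Nonempty (DihedralQuotient φ ω m k) := by
  induction m generalizing ω with
  | zero => exact absurd (one_lt_of_mem_letterSpan hφ h) (by omega)
  | succ m ih =>
    by_cases h' : φ = ω 0 ∧ φ ∈ letterSpan (shift ω) m
    · obtain ⟨rfl, h'⟩ := h'
      obtain ⟨k, hk, ⟨D⟩⟩ := ih (shift_ne_zero hω) h'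
      exact ⟨2 * k, by omega, ⟨D.extend (hω 0)⟩⟩
    · exact ⟨4, by omega, nonempty_dihedralQuotient_four hφ h fun h1 h2 => h' ⟨h1, h2⟩⟩

theorem dihedralQuotient_of_mem (hω : ∀ i, ω i ≠ 0) (hφ : φ ≠ 0) {r l : ℕ}
    (hr : ∀ i < r, ω i = φ) (hr' : ω r ≠ φ) (h : φ ∈ letterSpan (shift^[r] ω) l) :
    Nonempty (DihedralQuotient φ ω (r + l) (2 ^ (r + 2))) := by
  induction r generalizing ω with
  | zero =>
    have hl := one_lt_of_mem_letterSpan hφ h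
    obtain ⟨l, rfl⟩ : ∃ k, l = k + 1 := ⟨l - 1, by omega⟩
    rw [zero_add]
    exact nonempty_dihedralQuotient_four hφ h fun h1 => absurd h1.symm hr'
  | succ r ih =>
    obtain ⟨D⟩ := ih (shift_ne_zero hω) (fun i hi => hr (i + 1) (by omega)) hr' h
    obtain rfl := hr 0 (by omega)
    rw [show r + 1 + l = r + l + 1 by ring, show 2 ^ (r + 1 + 2) = 2 * 2 ^ (r + 2) by ring]
    exact ⟨D.extend (hω 0)⟩

/-- The last letter of the block already gives k = 4, and only the r letters before it double k; in
`dihedralQuotient_of_mem` the value 4 comes from the sequence after the block. -/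
theorem dihedralQuotient_of_notMem (hω : ∀ i, ω i ≠ 0) {r l : ℕ}
    (hr : ∀ i < r + 1, ω i = φ) (hl : 0 < l) (h : φ ∉ letterSpan (shift^[r + 1] ω) l) :
    Nonempty (DihedralQuotient φ ω (r + 1 + l) (2 ^ (r + 2))) := by
  have hφ : φ ≠ 0 := hr 0 (by omega) ▸ hω 0
  induction r generalizing ω with
  | zero =>
    rw [show 0 + 1 + l = l + 1 by ring]
    refine nonempty_dihedralQuotient_four hφ ?_ fun _ => h
    exact hr 0 (by omega) ▸ letter_mem_letterSpan (by omega)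
  | succ r ih =>
    obtain ⟨D⟩ := ih (shift_ne_zero hω) (fun i hi => hr (i + 1) (by omega)) h
    obtain rfl := hr 0 (by omega)
    rw [show r + 1 + 1 + l = r + 1 + l + 1 by ring,
      show 2 ^ (r + 1 + 2) = 2 * 2 ^ (r + 2) by ring]
    exact ⟨D.extend (hω 0)⟩

/-- An infinite index has value 0, so this is finiteness of the quotient, which taking logarithms
requires. -/
theorem quoCard_ne_zero (hω : ∀ i, ω i ≠ 0) (m : ℕ) : quoCard ω m ≠ 0 := by
  induction m generalizing ω with
  | zero => simp [quoCard_zero]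
  | succ m ih =>
    have h1 := ih (shift_ne_zero hω)
    by_cases h : ω 0 ∈ letterSpan (shift ω) m
    · obtain ⟨k, hk, ⟨D⟩⟩ := exists_dihedralQuotient (shift_ne_zero hω) (hω 0) h
      have : NeZero k := ⟨hk⟩
      have h2 := quoCard_succ_mul (hω 0) D
      intro h3
      rw [h3, zero_mul] at h2
      simp [h1] at h2
    · rw [quoCard_succ_of_notMem h]
      simp [h1]

/-- The binary logarithm of the order of `G_ω mod m`. -/
noncomputable def logCard (ω : ℕ → Module.Dual (ZMod 2) B) (m : ℕ) : ℝ :=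
  Real.logb 2 (quoCard ω m)

theorem logCard_succ_of_notMem (hω : ∀ i, ω i ≠ 0) {m : ℕ} (h : ω 0 ∉ letterSpan (shift ω) m) :
    logCard ω (m + 1) = 1 + 2 * logCard (shift ω) m := by
  have h0 : (quoCard (shift ω) m : ℝ) ≠ 0 := by
    exact_mod_cast quoCard_ne_zero (shift_ne_zero hω) m
  rw [logCard, quoCard_succ_of_notMem h]
  push_cast
  rw [Real.logb_mul two_ne_zero (pow_ne_zero 2 h0), Real.logb_pow, logCard,
    Real.logb_self_eq_one one_lt_two]
  norm_num

theorem logCard_succ (hω : ∀ i, ω i ≠ 0) {m e : ℕ}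
    (D : DihedralQuotient (ω 0) (shift ω) m (2 ^ e)) :
    logCard ω (m + 1) = 1 + 2 * logCard (shift ω) m - (e + 1) := by
  have h0 : (quoCard (shift ω) m : ℝ) ≠ 0 := by
    exact_mod_cast quoCard_ne_zero (shift_ne_zero hω) m
  have h1 : (quoCard ω (m + 1) : ℝ) ≠ 0 := by exact_mod_cast quoCard_ne_zero hω (m + 1)
  have h2 : (quoCard ω (m + 1) : ℝ) * 2 ^ (e + 1) = 2 * (quoCard (shift ω) m : ℝ) ^ 2 := by
    rw [pow_succ']
    exact_mod_cast quoCard_succ_mul (hω 0) D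
  have h3 := congrArg (Real.logb 2) h2
  rw [Real.logb_mul h1 (by positivity), Real.logb_mul two_ne_zero (pow_ne_zero 2 h0),
    Real.logb_pow, Real.logb_pow, Real.logb_self_eq_one one_lt_two] at h3
  rw [logCard, logCard]
  push_cast at h3
  linarith

theorem logCard_one (hω : ∀ i, ω i ≠ 0) : logCard ω 1 = 1 := by
  have := logCard_succ_of_notMem (m := 0) hω
    (by rw [letterSpan_eq_bot _ (by omega), Submodule.mem_bot]; exact hω 0)
  rwa [zero_add, logCard.eq_1 (shift ω), quoCard_zero, Nat.cast_one, Real.logb_one, mul_zero,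
    add_zero] at this

/-- Each letter maps x to 2x − r − 2, with r the number of equal letters already treated; 3 + r is
the particular solution. -/
theorem logCard_of_mem (hω : ∀ i, ω i ≠ 0) (hφ : φ ≠ 0) {r l : ℕ}
    (hr : ∀ i < r, ω i = φ) (hr' : ω r ≠ φ) (h : φ ∈ letterSpan (shift^[r] ω) l) :
    logCard ω (r + l) = 3 + r + 2 ^ r * (logCard (shift^[r] ω) l - 3) := by
  induction r generalizing ω with
  | zero => simp
  | succ r ih =>
    obtain ⟨D⟩ := dihedralQuotient_of_mem (shift_ne_zero hω) hφ
      (fun i hi => hr (i + 1) (by omega)) hr' h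
    have h1 := ih (shift_ne_zero hω) (fun i hi => hr (i + 1) (by omega)) hr' h
    obtain rfl := hr 0 (by omega)
    rw [show r + 1 + l = r + l + 1 by ring, logCard_succ hω D, h1, Function.iterate_succ_apply]
    push_cast
    ring

/-- Same recursion, started by the last letter of the block, where 1 + 2L = 3 + 2(L − 1). -/
theorem logCard_of_notMem (hω : ∀ i, ω i ≠ 0) {r l : ℕ}
    (hr : ∀ i < r + 1, ω i = φ) (hl : 0 < l) (h : φ ∉ letterSpan (shift^[r + 1] ω) l) :
    logCard ω (r + 1 + l) = 3 + r + 2 ^ (r + 1) * (logCard (shift^[r + 1] ω) l - 1) := by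
  induction r generalizing ω with
  | zero =>
    obtain rfl := hr 0 (by omega)
    rw [show 0 + 1 + l = l + 1 by ring, logCard_succ_of_notMem hω h]
    simp only [zero_add, Function.iterate_one]
    push_cast
    ring
  | succ r ih =>
    obtain ⟨D⟩ := dihedralQuotient_of_notMem (shift_ne_zero hω)
      (fun i hi => hr (i + 1) (by omega)) hl h
    have h1 := ih (shift_ne_zero hω) (fun i hi => hr (i + 1) (by omega)) h
    obtain rfl := hr 0 (by omega)
    rw [show r + 1 + 1 + l = r + 1 + l + 1 by ring, logCard_succ hω D, h1,
      Function.iterate_succ_apply _ (r + 1)]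
    push_cast
    ring

/-- Only one level remains after the block, so the later letters span 0 and the rest contributes
`logCard_one`. -/
theorem logCard_of_const (hω : ∀ i, ω i ≠ 0) {r : ℕ} (hr : ∀ i < r + 1, ω i = φ) :
    logCard ω (r + 2) = r + 3 := by
  have h := logCard_of_notMem (l := 1) hω hr one_pos
    (by rw [letterSpan_eq_bot _ le_rfl, Submodule.mem_bot]; exact hr 0 (by omega) ▸ hω 0)
  rw [logCard_one (shift_iterate_ne_zero hω _)] at h
  rw [show r + 2 = r + 1 + 1 by ring, h]
  ring

end

end Spinal

namespace Spinal

/-! ### Removing the first syllable -/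

section
variable {V : Type*} {ω : ℕ → V}

theorem one_le_syllableNumber (ω : ℕ → V) (i : ℕ) : 1 ≤ syllableNumber ω i := by
  induction i with
  | zero => rfl
  | succ i ih => rw [syllableNumber]; split_ifs <;> omega

theorem syllableNumber_eq_one {r : ℕ} (hr : ∀ i < r, ω i = ω 0) {i : ℕ} (hi : i < r) :
    syllableNumber ω i = 1 := by
  induction i with
  | zero => rfl
  | succ i ih => rw [syllableNumber, if_pos (by rw [hr _ hi, hr i (by omega)]), ih (by omega)]

theorem eq_of_syllableNumber_le_one {i : ℕ} (hi : syllableNumber ω i ≤ 1) : ω i = ω 0 := by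
  induction i with
  | zero => rfl
  | succ i ih =>
    have := one_le_syllableNumber ω i
    rw [syllableNumber] at hi
    split_ifs at hi with h
    · rw [h, ih hi]
    · omega

theorem s_zero (ω : ℕ → V) : s ω 0 = 0 := by simp [s]

theorem s_succ (ω : ℕ → V) (k : ℕ) : s ω (k + 1) = s ω k + mult ω (k + 1) := by
  rw [s, Finset.sum_Icc_succ_top (by omega), s]

theorem s_le_succ (ω : ℕ → V) (k : ℕ) : s ω k ≤ s ω (k + 1) := by
  rw [s_succ]; exact le_self_add

theorem bigSigma_succ (ω : ℕ → V) (k : ℕ) :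
    bigSigma ω (k + 1) = bigSigma ω k + 2 ^ (s ω k).toNat * (mult ω (k + 1)).toNat := by
  rw [bigSigma, Finset.sum_Icc_succ_top (by omega), bigSigma, Nat.add_sub_cancel]

theorem le_mult_one {r : ℕ} (hr : ∀ i < r, ω i = ω 0) : (r : ℕ∞) ≤ mult ω 1 := by
  have : (Finset.range r : Set ℕ).encard = r := by
    rw [Set.encard_coe_eq_coe_finsetCard, Finset.card_range]
  rw [mult, ← this]
  exact Set.encard_le_encard fun i hi => syllableNumber_eq_one hr (by simpa using hi)

theorem sInv_eq_one {m : ℕ} (hm : 2 ≤ m) (h : ∀ i, i + 1 < m → ω i = ω 0) : sInv ω m = 1 := by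
  obtain ⟨r, rfl⟩ : ∃ r, m = r + 1 := ⟨m - 1, by omega⟩
  refine IsLeast.csInf_eq ⟨⟨le_rfl, ?_, ?_⟩, fun k hk => hk.1⟩
  · rw [Nat.sub_self, s_zero, zero_add]
    exact_mod_cast (by omega : 1 < r + 1)
  · rw [s_succ, s_zero, zero_add]
    push_cast
    gcongr
    exact le_mult_one fun i hi => h i (by omega)

theorem sInv_eq_zero {m : ℕ} (hm : m ≤ 1) : sInv ω m = 0 := by
  rw [sInv, Nat.sInf_eq_zero]
  refine Or.inr (Set.eq_empty_of_forall_notMem ?_)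
  rintro k ⟨-, hk, -⟩
  have : (m : ℕ∞) ≤ 1 := by exact_mod_cast hm
  exact absurd (hk.trans_le this) (by simp)

/-- The first syllable of `ω` has length `r`. -/
structure IsFirstSyllable (ω : ℕ → V) (r : ℕ) : Prop where
  pos : 0 < r
  eq : ∀ i < r, ω i = ω 0
  ne : ω r ≠ ω 0

/-- The first change of letter, if among the first m − 1 letters, leaves at least one visible letter
after it, hence `2 ≤ l`. -/
theorem const_or_isFirstSyllable (ω : ℕ → V) (m : ℕ) : (∀ i, i + 1 < m → ω i = ω 0) ∨
    ∃ r l, 2 ≤ l ∧ m = r + l ∧ IsFirstSyllable ω r := by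
  classical
  by_cases h : ∀ i, i + 1 < m → ω i = ω 0
  · exact Or.inl h
  · push Not at h
    have hex : ∃ i, ω i ≠ ω 0 := ⟨_, h.choose_spec.2⟩
    obtain ⟨i, hi, hi'⟩ := h
    have hle := Nat.find_min' hex hi'
    refine Or.inr ⟨Nat.find hex, m - Nat.find hex, by omega, by omega, ?_, ?_, Nat.find_spec hex⟩
    · rw [Nat.pos_iff_ne_zero]
      intro h0
      have := Nat.find_spec hex
      rw [h0] at this
      exact this rfl
    · exact fun j hj => not_not.1 (Nat.find_min hex hj)

namespace IsFirstSyllable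
variable {r : ℕ}

theorem syllableNumber_add (h : IsFirstSyllable ω r) (i : ℕ) :
    syllableNumber ω (r + i) = syllableNumber (shift^[r] ω) i + 1 := by
  induction i with
  | zero =>
    obtain ⟨r, rfl⟩ : ∃ k, r = k + 1 := ⟨r - 1, by have := h.pos; omega⟩
    have hne : ω (r + 1) ≠ ω r := by rw [h.eq r (by omega)]; exact h.ne
    rw [add_zero, syllableNumber.eq_2, if_neg hne, syllableNumber_eq_one h.eq (by omega)]
    rfl
  | succ i ih =>
    rw [← add_assoc, syllableNumber, syllableNumber, shift_iterate_apply, shift_iterate_apply,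
      ih, ← add_assoc]
    split_ifs <;> rfl

theorem mult_one (h : IsFirstSyllable ω r) : mult ω 1 = r := by
  have : {i | syllableNumber ω i = 1} = (Finset.range r : Set ℕ) := by
    ext i
    simp only [Set.mem_ofPred_eq, Finset.coe_range, Set.mem_Iio]
    refine ⟨fun hi => ?_, syllableNumber_eq_one h.eq⟩
    by_contra hlt
    obtain ⟨j, rfl⟩ := Nat.exists_eq_add_of_le (not_lt.1 hlt)
    rw [h.syllableNumber_add] at hi
    have := one_le_syllableNumber (shift^[r] ω) j
    omega
  rw [mult, this, Set.encard_coe_eq_coe_finsetCard, Finset.card_range]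

theorem mult_succ (h : IsFirstSyllable ω r) {k : ℕ} (hk : 1 ≤ k) :
    mult ω (k + 1) = mult (shift^[r] ω) k := by
  have : {i | syllableNumber ω i = k + 1} =
      (fun i => r + i) '' {i | syllableNumber (shift^[r] ω) i = k} := by
    ext i
    simp only [Set.mem_ofPred_eq, Set.mem_image]
    constructor
    · intro hi
      have hle : r ≤ i := by
        by_contra hlt
        rw [syllableNumber_eq_one h.eq (not_le.1 hlt)] at hi
        omega
      obtain ⟨j, rfl⟩ := Nat.exists_eq_add_of_le hle
      rw [h.syllableNumber_add] at hi
      exact ⟨j, by omega, rfl⟩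
    · rintro ⟨j, hj, rfl⟩
      rw [h.syllableNumber_add, hj]
  rw [mult, this, (add_right_injective r).encard_image, mult]

theorem s_succ (h : IsFirstSyllable ω r) (k : ℕ) : s ω (k + 1) = r + s (shift^[r] ω) k := by
  induction k with
  | zero => rw [Spinal.s_succ, s_zero, s_zero, zero_add, add_zero, h.mult_one]
  | succ k ih => rw [Spinal.s_succ, ih, h.mult_succ (by omega), Spinal.s_succ, add_assoc]

theorem toNat_s_succ (h : IsFirstSyllable ω r) {k : ℕ} (hk : s (shift^[r] ω) k ≠ ⊤) :
    (s ω (k + 1)).toNat = r + (s (shift^[r] ω) k).toNat := by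
  rw [h.s_succ, ENat.toNat_add (ENat.natCast_ne_top r) hk, ENat.toNat_natCast]

theorem bigSigma_succ (h : IsFirstSyllable ω r) {k : ℕ} (hk : s (shift^[r] ω) k ≠ ⊤) :
    bigSigma ω (k + 1) = r + 2 ^ r * bigSigma (shift^[r] ω) k := by
  induction k with
  | zero => simp [bigSigma, s_zero, h.mult_one]
  | succ k ih =>
    have hk' := ne_top_of_le_ne_top hk (s_le_succ _ _)
    rw [Spinal.bigSigma_succ, ih hk', Spinal.bigSigma_succ, h.toNat_s_succ hk',
      h.mult_succ (by omega), pow_add]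
    ring

theorem mem_sInv_iff (h : IsFirstSyllable ω r) {l k : ℕ} (hl : 2 ≤ l) :
    (1 ≤ k ∧ s ω (k - 1) + 1 < ((r + l : ℕ) : ℕ∞) ∧ ((r + l : ℕ) : ℕ∞) ≤ s ω k + 1) ↔
      ∃ k', k = k' + 1 ∧ 1 ≤ k' ∧ s (shift^[r] ω) (k' - 1) + 1 < (l : ℕ∞) ∧
        (l : ℕ∞) ≤ s (shift^[r] ω) k' + 1 := by
  have hr : (r : ℕ∞) ≠ ⊤ := ENat.natCast_ne_top r
  rcases k with _ | _ | k
  · simp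
  -- The first syllable is not the answer, because r + l > r + 1.
  · have : ¬ ((r + l : ℕ) : ℕ∞) ≤ s ω (0 + 1) + 1 := by
      rw [h.s_succ, s_zero, add_zero]
      exact_mod_cast (by omega : ¬ r + l ≤ r + 1)
    constructor
    · exact fun hk => absurd hk.2.2 this
    · rintro ⟨k', hk', h1, -⟩
      omega
  · have h1 : s ω (k + 1 + 1 - 1) + 1 < ((r + l : ℕ) : ℕ∞) ↔
        s (shift^[r] ω) (k + 1 - 1) + 1 < (l : ℕ∞) := by
      rw [Nat.add_sub_cancel, Nat.add_sub_cancel, h.s_succ, Nat.cast_add, add_assoc,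
        ENat.add_lt_add_iff_left hr]
    have h2 : ((r + l : ℕ) : ℕ∞) ≤ s ω (k + 1 + 1) + 1 ↔
        (l : ℕ∞) ≤ s (shift^[r] ω) (k + 1) + 1 := by
      rw [h.s_succ, Nat.cast_add, add_assoc, ENat.add_le_add_iff_left hr]
    rw [h1, h2]
    constructor
    · rintro ⟨-, h3, h4⟩
      exact ⟨k + 1, rfl, by omega, h3, h4⟩
    · rintro ⟨k', hk', -, h3, h4⟩
      obtain rfl : k' = k + 1 := by omega
      exact ⟨by omega, h3, h4⟩

theorem sInv_add_of_pos (h : IsFirstSyllable ω r) {l : ℕ} (hl : 2 ≤ l)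
    (hpos : 1 ≤ sInv (shift^[r] ω) l) : sInv ω (r + l) = sInv (shift^[r] ω) l + 1 := by
  have hmem := Nat.sInf_mem (Nat.nonempty_of_pos_sInf hpos)
  refine IsLeast.csInf_eq ⟨(h.mem_sInv_iff hl).2 ⟨_, rfl, hmem⟩, fun k hk => ?_⟩
  obtain ⟨k', rfl, hk'⟩ := (h.mem_sInv_iff hl).1 hk
  exact Nat.succ_le_succ (Nat.sInf_le hk')

end IsFirstSyllable

/-- Positivity means that the defining set is nonempty, since `sInf ∅ = 0`. -/
theorem one_le_sInv (ω : ℕ → V) {m : ℕ} (hm : 2 ≤ m) : 1 ≤ sInv ω m := by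
  induction m using Nat.strong_induction_on generalizing ω with
  | _ m ih =>
    rcases const_or_isFirstSyllable ω m with h | ⟨r, l, hl, rfl, h⟩
    · rw [sInv_eq_one hm h]
    · rw [h.sInv_add_of_pos hl (ih l (by have := h.pos; omega) _ hl)]
      omega

theorem IsFirstSyllable.sInv_add {r l : ℕ} (h : IsFirstSyllable ω r) (hl : 2 ≤ l) :
    sInv ω (r + l) = sInv (shift^[r] ω) l + 1 :=
  h.sInv_add_of_pos hl (one_le_sInv _ hl)

theorem s_sInv_sub_one_ne_top (ω : ℕ → V) {m : ℕ} (hm : 2 ≤ m) : s ω (sInv ω m - 1) ≠ ⊤ := by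
  have := (Nat.sInf_mem (Nat.nonempty_of_pos_sInf (one_le_sInv ω hm))).2.1
  intro h
  change s ω (sInv ω m - 1) + 1 < m at this
  rw [h] at this
  simp at this

theorem IsFirstSyllable.letters_eq {r l : ℕ} (h : IsFirstSyllable ω r) (hl : 2 ≤ l) :
    {φ | ∃ i, i + 1 < r + l ∧ ω i = φ} =
      insert (ω 0) {φ | ∃ i, i + 1 < l ∧ shift^[r] ω i = φ} := by
  ext φ
  simp only [Set.mem_ofPred_eq, Set.mem_insert_iff, shift_iterate_apply]
  constructor
  · rintro ⟨i, hi, rfl⟩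
    rcases lt_or_ge i r with hlt | hge
    · exact Or.inl (h.eq i hlt)
    · obtain ⟨j, rfl⟩ := Nat.exists_eq_add_of_le hge
      exact Or.inr ⟨j, by omega, rfl⟩
  · rintro (rfl | ⟨j, hj, rfl⟩)
    · exact ⟨0, by omega, rfl⟩
    · exact ⟨r + j, by omega, rfl⟩

/-- The last counted syllable may extend beyond position m − 1, even indefinitely, but it only
repeats a letter already seen. -/
theorem syllable_letters_eq (ω : ℕ → V) (m : ℕ) :
    {φ | ∃ i, syllableNumber ω i ≤ sInv ω m ∧ ω i = φ} = {φ | ∃ i, i + 1 < m ∧ ω i = φ} := by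
  induction m using Nat.strong_induction_on generalizing ω with
  | _ m ih =>
    rcases lt_or_ge m 2 with hm | hm
    · rw [sInv_eq_zero (by omega)]
      ext φ
      constructor
      · rintro ⟨i, hi, -⟩
        have := one_le_syllableNumber ω i
        omega
      · rintro ⟨i, hi, -⟩
        omega
    rcases const_or_isFirstSyllable ω m with h | ⟨r, l, hl, rfl, h⟩
    · rw [sInv_eq_one hm h]
      ext φ
      constructor
      · rintro ⟨i, hi, rfl⟩
        exact ⟨0, by omega, (eq_of_syllableNumber_le_one hi).symm⟩
      · rintro ⟨i, hi, rfl⟩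
        exact ⟨0, le_rfl, (h i hi).symm⟩
    · rw [h.letters_eq hl, ← ih l (by have := h.pos; omega), h.sInv_add hl]
      ext φ
      simp only [Set.mem_ofPred_eq, Set.mem_insert_iff]
      constructor
      · rintro ⟨i, hi, rfl⟩
        rcases lt_or_ge i r with hlt | hge
        · exact Or.inl (h.eq i hlt)
        · obtain ⟨j, rfl⟩ := Nat.exists_eq_add_of_le hge
          rw [h.syllableNumber_add] at hi
          exact Or.inr ⟨j, by omega, shift_iterate_apply ω r j⟩
      · rintro (rfl | ⟨j, hj, rfl⟩)
        · exact ⟨0, by simp [syllableNumber], rfl⟩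
        · exact ⟨r + j, by rw [h.syllableNumber_add]; omega, (shift_iterate_apply ω r j).symm⟩

/-! ### Dimensions of spans of letters, and the indices at which they drop. -/

variable [AddCommGroup V] [Module (ZMod 2) V]

theorem dimMod_eq_finrank (ω : ℕ → V) (m : ℕ) :
    dimMod ω m = Module.finrank (ZMod 2) (letterSpan ω m) := by
  rw [dimMod, syllable_letters_eq, letterSpan]

namespace IsFirstSyllable
variable {r l : ℕ}

theorem letterSpan_eq (h : IsFirstSyllable ω r) (hl : 2 ≤ l) :
    letterSpan ω (r + l) = Submodule.span (ZMod 2) {ω 0} ⊔ letterSpan (shift^[r] ω) l := by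
  rw [letterSpan, h.letters_eq hl, Submodule.span_insert, letterSpan]

theorem dimMod_of_mem (h : IsFirstSyllable ω r) (hl : 2 ≤ l)
    (hmem : ω 0 ∈ letterSpan (shift^[r] ω) l) : dimMod ω (r + l) = dimMod (shift^[r] ω) l := by
  rw [dimMod_eq_finrank, dimMod_eq_finrank, h.letterSpan_eq hl,
    sup_eq_right.2 ((Submodule.span_singleton_le_iff_mem _ _).2 hmem)]

theorem dimMod_of_notMem [FiniteDimensional (ZMod 2) V] (h : IsFirstSyllable ω r) (hl : 2 ≤ l)
    (hmem : ω 0 ∉ letterSpan (shift^[r] ω) l) :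
    dimMod ω (r + l) = dimMod (shift^[r] ω) l + 1 := by
  have h0 : ω 0 ≠ 0 := fun h0 => hmem (h0 ▸ zero_mem _)
  have hd : Submodule.span (ZMod 2) {ω 0} ⊓ letterSpan (shift^[r] ω) l = ⊥ := by
    rw [inf_comm, ← disjoint_iff]
    exact (Submodule.disjoint_span_singleton' h0).2 hmem
  have := Submodule.finrank_sup_add_finrank_inf_eq (Submodule.span (ZMod 2) {ω 0})
    (letterSpan (shift^[r] ω) l)
  rw [hd, finrank_bot, finrank_span_singleton h0, ← h.letterSpan_eq hl] at this
  rw [dimMod_eq_finrank, dimMod_eq_finrank]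
  omega

theorem succ_mem_dropSet_iff (h : IsFirstSyllable ω r) {j k : ℕ} :
    k + 1 ∈ dropSet ω (r + l) j ↔ k ∈ dropSet (shift^[r] ω) l j := by
  simp only [dropSet, Set.mem_ofPred_eq, h.s_succ]
  constructor
  · rintro ⟨t, ht, htm, hd⟩
    have hne : s (shift^[r] ω) k ≠ ⊤ := by
      rintro h0
      rw [h0, add_top] at ht
      exact ENat.natCast_ne_top t ht.symm
    obtain ⟨t', ht'⟩ := ENat.ne_top_iff_exists.1 hne
    rw [← ht'] at ht
    obtain rfl : t = r + t' := by exact_mod_cast ht.symm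
    refine ⟨t', ht'.symm, by omega, ?_⟩
    rwa [add_comm r t', Function.iterate_add_apply, add_comm t' r, Nat.add_sub_add_left] at hd
  · rintro ⟨t, ht, htm, hd⟩
    refine ⟨r + t, by rw [ht]; rfl, by omega, ?_⟩
    rwa [add_comm r t, Function.iterate_add_apply, add_comm t r, Nat.add_sub_add_left]

end IsFirstSyllable

theorem dimMod_eq_of_zero_mem_dropSet {m j : ℕ} (h : 0 ∈ dropSet ω m j) : dimMod ω m = j := by
  obtain ⟨t, ht, -, hd⟩ := h
  rw [s_zero] at ht
  obtain rfl : t = 0 := by exact_mod_cast ht.symm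
  simpa using hd

/-- Index 0 belongs only to the full dimension, so for other j the minimum is inherited from the
shifted sequence and moves by one. -/
theorem IsFirstSyllable.isLeast_dropSet {r l j k : ℕ} (h : IsFirstSyllable ω r)
    (hne : dimMod ω (r + l) ≠ j) (hk : IsLeast (dropSet (shift^[r] ω) l j) k) :
    IsLeast (dropSet ω (r + l) j) (k + 1) := by
  refine ⟨h.succ_mem_dropSet_iff.2 hk.1, ?_⟩
  rintro (_ | i) hi
  · exact absurd (dimMod_eq_of_zero_mem_dropSet hi) hne
  · exact Nat.succ_le_succ (hk.2 (h.succ_mem_dropSet_iff.1 hi))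

theorem isLeast_dropSet_zero {m : ℕ} (hm : 0 < m) : IsLeast (dropSet ω m (dimMod ω m)) 0 :=
  ⟨⟨0, s_zero ω, hm, rfl⟩, fun _ _ => Nat.zero_le _⟩

theorem s_ne_top_of_mem_dropSet {m j k : ℕ} (h : k ∈ dropSet ω m j) : s ω k ≠ ⊤ := by
  obtain ⟨t, ht, -⟩ := h
  rw [ht]
  exact ENat.natCast_ne_top t

theorem eq_of_dimMod_eq_one (hω : ∀ i, ω i ≠ 0) {m : ℕ} (hm : 2 ≤ m) (h : dimMod ω m = 1) {i : ℕ}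
    (hi : i + 1 < m) : ω i = ω 0 := by
  rw [dimMod_eq_finrank, finrank_eq_one_iff_of_nonzero'
    (⟨ω 0, letter_mem_letterSpan (by omega)⟩ : letterSpan ω m)
    (fun h0 => hω 0 (congrArg Subtype.val h0))] at h
  obtain ⟨c, hc⟩ := h ⟨ω i, letter_mem_letterSpan hi⟩
  replace hc : c • ω 0 = ω i := congrArg Subtype.val hc
  have : c = 0 ∨ c = 1 := by clear hc; revert c; decide
  rcases this with rfl | rfl
  · exact absurd (by rw [← hc, zero_smul]) (hω i)
  · rw [← hc, one_smul]

theorem two_le_of_dimMod_pos {m : ℕ} (h : 0 < dimMod ω m) : 2 ≤ m := by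
  by_contra hm
  rw [dimMod_eq_finrank, letterSpan_eq_bot ω (by omega), finrank_bot] at h
  exact lt_irrefl _ h

end

end Spinal

/-! ### The order formula, by induction over the syllables. -/

namespace Spinal

theorem logCard_eq {B : Type*} [AddCommGroup B] [Module (ZMod 2) B]
    [FiniteDimensional (ZMod 2) B] (ω : ℕ → Module.Dual (ZMod 2) B) (hω : ∀ i, ω i ≠ 0)
    (m n : ℕ) (hn : 2 ≤ n) (hdim : dimMod ω m = n) :
    ∃ lam : ℕ → ℕ,
      (∀ j ∈ Finset.Icc 1 (n - 1), 1 ≤ lam j ∧ IsLeast (dropSet ω m j) (lam j)) ∧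
      logCard ω m = 3 + (bigSigma ω (sInv ω m - 1) : ℝ)
          + ∑ i ∈ Finset.Icc 2 (n - 1),
              ((2 : ℝ) ^ ((s ω (lam i)).toNat + 1) - (2 : ℝ) ^ (s ω (lam i - 1)).toNat)
          - (2 : ℝ) ^ (s ω (lam 1 - 1)).toNat
          + (2 : ℝ) ^ (s ω (lam 1)).toNat * ((m : ℝ) - ((s ω (lam 1)).toNat : ℝ)) := by
  induction m using Nat.strong_induction_on generalizing ω n with
  | _ m ih =>
    have hm : 2 ≤ m := two_le_of_dimMod_pos (ω := ω) (by omega)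
    rcases const_or_isFirstSyllable ω m with h | ⟨r, l, hl, rfl, h⟩
    · exfalso
      have hle : letterSpan ω m ≤ Submodule.span (ZMod 2) {ω 0} :=
        Submodule.span_mono (by rintro _ ⟨i, hi, rfl⟩; exact h i hi)
      have := Submodule.finrank_mono hle
      rw [← dimMod_eq_finrank, finrank_span_singleton (hω 0)] at this
      omega
    have hr := h.pos
    have hω' := shift_iterate_ne_zero hω r
    have hsInv := h.sInv_add hl
    have hsInv' := one_le_sInv (shift^[r] ω) hl
    have hsig : bigSigma ω (sInv ω (r + l) - 1) =
        r + 2 ^ r * bigSigma (shift^[r] ω) (sInv (shift^[r] ω) l - 1) := by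
      rw [← h.bigSigma_succ (s_sInv_sub_one_ne_top _ hl), hsInv]
      congr 1
      omega
    -- the terms for an index inherited from the shifted sequence
    have hterm {k j : ℕ} (hk : 1 ≤ k) (hmem : k ∈ dropSet (shift^[r] ω) l j) :
        (s ω (k + 1)).toNat = r + (s (shift^[r] ω) k).toNat ∧
          (s ω (k + 1 - 1)).toNat = r + (s (shift^[r] ω) (k - 1)).toNat := by
      obtain ⟨k, rfl⟩ : ∃ i, k = i + 1 := ⟨k - 1, by omega⟩
      have hne := s_ne_top_of_mem_dropSet hmem
      exact ⟨h.toNat_s_succ hne, h.toNat_s_succ (ne_top_of_le_ne_top hne (s_le_succ _ _))⟩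
    have hs1 : (s ω 1).toNat = r := by
      rw [h.toNat_s_succ (by simp [s_zero]), s_zero]; simp
    have hs0 : (s ω 0).toNat = 0 := by simp [s_zero]
    by_cases hmem : ω 0 ∈ letterSpan (shift^[r] ω) l
    -- The dimension is unchanged, so every index moves by one and every power of two is multiplied
    -- by 2^r.
    · have hd := h.dimMod_of_mem hl hmem
      obtain ⟨lam, hlam, hL⟩ := ih l (by omega) (shift^[r] ω) hω' n hn (hd ▸ hdim)
      refine ⟨fun j => lam j + 1, fun j hj => ⟨Nat.le_add_left 1 _, ?_⟩, ?_⟩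
      · refine h.isLeast_dropSet ?_ (hlam j hj).2
        rw [Finset.mem_Icc] at hj
        omega
      · have h1 := hlam 1 (by rw [Finset.mem_Icc]; omega)
        have h1' := hterm h1.1 h1.2.1
        have hsum : ∑ i ∈ Finset.Icc 2 (n - 1), ((2 : ℝ) ^ ((s ω (lam i + 1)).toNat + 1) -
            (2 : ℝ) ^ (s ω (lam i + 1 - 1)).toNat) = 2 ^ r * ∑ i ∈ Finset.Icc 2 (n - 1),
              ((2 : ℝ) ^ ((s (shift^[r] ω) (lam i)).toNat + 1) -
                (2 : ℝ) ^ (s (shift^[r] ω) (lam i - 1)).toNat) := by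
          rw [Finset.mul_sum]
          refine Finset.sum_congr rfl fun i hi => ?_
          rw [Finset.mem_Icc] at hi
          have h2 := hlam i (by rw [Finset.mem_Icc]; omega)
          have h2' := hterm h2.1 h2.2.1
          rw [h2'.1, h2'.2, add_assoc, pow_add, pow_add _ r]
          ring
        rw [logCard_of_mem hω (hω 0) h.eq h.ne hmem, hL, hsum, hsig, h1'.1, h1'.2]
        push_cast
        rw [pow_add, pow_add]
        ring
    · have hd := h.dimMod_of_notMem hl hmem
      have hcard : logCard ω (r + l) = 2 + r + 2 ^ r * (logCard (shift^[r] ω) l - 1) := by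
        obtain ⟨q, rfl⟩ : ∃ q, r = q + 1 := ⟨r - 1, by omega⟩
        rw [logCard_of_notMem hω h.eq (by omega) hmem]
        push_cast
        ring
      -- Removing the first syllable lowers the dimension by exactly one, so n − 1 is first attained
      -- at index 1, where s_1 = r and s_0 = 0.
      have hone : IsLeast (dropSet ω (r + l) (n - 1)) 1 := by
        refine h.isLeast_dropSet (by omega) ?_
        rw [show n - 1 = dimMod (shift^[r] ω) l by omega]
        exact isLeast_dropSet_zero (by omega)
      rcases hn.eq_or_lt with rfl | hn
      · refine ⟨fun _ => 1, fun j hj => ⟨le_rfl, ?_⟩, ?_⟩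
        · obtain rfl : j = 1 := by rw [Finset.mem_Icc] at hj; omega
          exact hone
        -- For n = 2 the rest spans a line, whose only nonzero vector over Z/2 is its single letter;
        -- both sides become 2 + r + 2^r l.
        · have hconst := fun i => eq_of_dimMod_eq_one (i := i) hω' hl (by omega)
          have hlog : logCard (shift^[r] ω) l = l + 1 := by
            obtain ⟨q, rfl⟩ : ∃ q, l = q + 2 := ⟨l - 2, by omega⟩
            rw [logCard_of_const (r := q) hω' fun i hi => hconst i (by omega)]
            push_cast
            ring
          have hs : bigSigma (shift^[r] ω) (sInv (shift^[r] ω) l - 1) = 0 := by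
            rw [sInv_eq_one hl hconst]
            rfl
          simp only [hcard, hlog, hsig, hs, hs1, hs0, Nat.sub_self]
          rw [Finset.Icc_eq_empty (by omega), Finset.sum_empty]
          push_cast
          ring
      · obtain ⟨lam, hlam, hL⟩ := ih l (by omega) (shift^[r] ω) hω' (n - 1) (by omega) (by omega)
        have hlt {j : ℕ} (hj : j < n - 1) :
            (if j = n - 1 then 1 else lam j + 1) = lam j + 1 := if_neg (by omega)
        refine ⟨fun j => if j = n - 1 then 1 else lam j + 1, fun j hj => ?_, ?_⟩
        · rw [Finset.mem_Icc] at hj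
          beta_reduce
          split_ifs with hjn
          · exact ⟨le_rfl, hjn ▸ hone⟩
          · exact ⟨by omega, h.isLeast_dropSet (by omega)
              (hlam j (by rw [Finset.mem_Icc]; omega)).2⟩
        · have h1 := hlam 1 (by rw [Finset.mem_Icc]; omega)
          have h1' := hterm h1.1 h1.2.1
          -- The top summand i = n − 1 is the new one, 2^{r+1} − 2^0; the others are inherited with
          -- the factor 2^r.
          have hsum : ∑ i ∈ Finset.Icc 2 (n - 1),
              ((2 : ℝ) ^ ((s ω (if i = n - 1 then 1 else lam i + 1)).toNat + 1) -
                (2 : ℝ) ^ (s ω ((if i = n - 1 then 1 else lam i + 1) - 1)).toNat) =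
              2 ^ r * ∑ i ∈ Finset.Icc 2 (n - 1 - 1),
                ((2 : ℝ) ^ ((s (shift^[r] ω) (lam i)).toNat + 1) -
                  (2 : ℝ) ^ (s (shift^[r] ω) (lam i - 1)).toNat) + (2 ^ (r + 1) - 1) := by
            obtain ⟨q, hq⟩ : ∃ q, n - 1 = q + 1 := ⟨n - 2, by omega⟩
            rw [hq, Finset.sum_Icc_succ_top (by omega), if_pos rfl, hs1, Nat.sub_self, hs0,
              pow_zero, Finset.mul_sum, Nat.add_sub_cancel]
            congr 1
            refine Finset.sum_congr rfl fun i hi => ?_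
            rw [Finset.mem_Icc] at hi
            have h2 := hlam i (by rw [Finset.mem_Icc]; omega)
            have h2' := hterm h2.1 h2.2.1
            rw [if_neg (by omega), h2'.1, h2'.2, add_assoc, pow_add, pow_add _ r]
            ring
          beta_reduce
          rw [hcard, hL, hsum, hsig, hlt (by omega), h1'.1, h1'.2]
          push_cast
          rw [pow_add, pow_add _ r (s (shift^[r] ω) (lam 1)).toNat, pow_succ]
          ring

end Spinal

theorem proposition6p11 {B : Type*} [AddCommGroup B] [Module (ZMod 2) B]
    [FiniteDimensional (ZMod 2) B]
    (ω : ℕ → Module.Dual (ZMod 2) B) (hω : ∀ i, ω i ≠ 0)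
    (m n : ℕ) (hn : 2 ≤ n) (hdim : Spinal.dimMod ω m = n) :
    ∃ lam : ℕ → ℕ,
      (∀ j ∈ Finset.Icc 1 (n - 1), 1 ≤ lam j ∧ IsLeast (Spinal.dropSet ω m j) (lam j)) ∧
      Spinal.s ω (Spinal.sInv ω m - 1) ≠ ⊤ ∧
      Finite (Spinal.Quo (Spinal.spinalGroup ω) m) ∧
      Real.logb 2 (Nat.card (Spinal.Quo (Spinal.spinalGroup ω) m)) =
        3 + (Spinal.bigSigma ω (Spinal.sInv ω m - 1) : ℝ)
          + ∑ i ∈ Finset.Icc 2 (n - 1),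
              ((2 : ℝ) ^ ((Spinal.s ω (lam i)).toNat + 1)
                - (2 : ℝ) ^ (Spinal.s ω (lam i - 1)).toNat)
          - (2 : ℝ) ^ (Spinal.s ω (lam 1 - 1)).toNat
          + (2 : ℝ) ^ (Spinal.s ω (lam 1)).toNat * ((m : ℝ) - ((Spinal.s ω (lam 1)).toNat : ℝ)) := by
  obtain ⟨lam, hlam, hL⟩ := Spinal.logCard_eq ω hω m n hn hdim
  refine ⟨lam, hlam, Spinal.s_sInv_sub_one_ne_top ω
    (Spinal.two_le_of_dimMod_pos (ω := ω) (by omega)), ?_, ?_⟩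
  · refine Nat.finite_of_card_ne_zero ?_
    rw [Spinal.nat_card_quo]
    exact Spinal.quoCard_ne_zero hω m
  · rw [Spinal.nat_card_quo]
    exact hL
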